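/- Let $M:\mathbb{R}\to\mathbb{R}$ be a Young function: $M$ is even, convex, continuous, $M(t)>0$ for $t>0$, $M(t)/t\to0$ as $t\to0^+$, $M(t)/t\to\infty$ as $t\to\infty$, and $M(t)=\int_0^{|t|}m$ with $m:[0,\infty)\to[0,\infty)$ nondecreasing, right continuous, $m(t)=0$ iff $t=0$, and $m(t)\to\infty$ as $t\to\infty$. Let $\bar M(t)=\sup_{\tau\ge0}(\tau|t|-M(\tau))$. For a measure $\mu$, let $L_M(\mu)$ be the space of $\mu$-measurable $u$ with $\int M(u/k)\,d\mu<\infty$ for some $k>0$, with the Luxemburg norm, and let $E_M(\mu)$ be the norm closure in $L_M(\mu)$ of the bounded measurable functions whose support is bounded and of finite measure. Write $L_M=L_M(\mathbb{R}^n,dx)$ and $L_M(\nu_n)=L_M(\mathbb{R}^{2n},d\nu_n)$ with $d\nu_n=|x-y|^{-n}\,dx\,dy$, and similarly for $E_M$. Let $0<s<1$, $D^su(x,y)=\frac{u(x)-u(y)}{|x-y|^s}$ and $W^sL_M=\{u\in L_M: D^su\in L_M(\nu_n)\}$, and put $$\langle(f,F),u\rangle=\int_{\mathbb{R}^n}fu\,dx+\iint_{\mathbb{R}^{2n}}F\,D^su\,d\nu_n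 .$$ Let $\Omega\subset\mathbb{R}^n$ be open and bounded. Let $W^s_0L_M(\Omega)$ be the closure of $\mathcal{D}(\Omega)=C_c^\infty(\Omega)$ in $W^sL_M$ for the topology $\sigma(L_M\times L_M(\nu_n),E_{\bar M}\times E_{\bar M}(\nu_n))$, i.e. the coarsest one making $u\mapsto\langle(f,F),u\rangle$ continuous for all $f\in E_{\bar M}$, $F\in E_{\bar M}(\nu_n)$. Let $W^{-s}L_{\bar M}(\Omega)$ be the space of distributions on $\Omega$ of the form $T=f+\mathrm{div}^sF$ with $f\in L_{\bar M}$, $F\in L_{\bar M}(\nu_n)$, where $\langle\mathrm{div}^sF,\varphi\rangle=\iint F\,D^s\varphi\,d\nu_n$ for $\varphi\in\mathcal{D}(\Omega)$. Assume that $\Omega$ has the segment property: there are $r>0$, $\tau_0\in(0,1)$, a locally finite covering of $\partial\Omega$ by balls $B_r(x_j)$ with $x_j\in\partial\Omega$, and unit vectors $n_j$ such that $x+\tau n_j\in\Omega$ for all $x\in\overline\Omega\cap B_r(x_j)$ and all $\tau\in(0,\tau_0)$. Then the pairing $\langle T,u\rangle:=\langle(f,F),u\rangle$ of $T=f+\mathrm{div}^sF\in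 W^{-s}L_{\bar M}(\Omega)$ with $u\in W^s_0L_M(\Omega)$ does not depend on the representation $(f,F)$ of $T$, and $\mathcal{D}(\Omega)\subset W^s_0L_M(\Omega)$ is dense in $W^s_0L_M(\Omega)$ for the topology $\sigma(W^s_0L_M(\Omega),W^{-s}L_{\bar M}(\Omega))$, the coarsest topology making $u\mapsto\langle T,u\rangle$ continuous for every $T\in W^{-s}L_{\bar M}(\Omega)$. -/

import Mathlib

open MeasureTheory Set Filter Topology TopologicalSpace
open scoped Distributions

namespace FracOrlicz

noncomputable section

/-! ### Young functions and Orlicz spaces -/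

/-- Young functions: even, convex, continuous, positive away from `0`, with `M t / t → 0` at `0`
and `M t / t → ∞` at infinity, and of the form `M t = ∫₀^{|t|} m` with `m : [0, ∞) → [0, ∞)`
nondecreasing, right continuous, vanishing exactly at `0` and tending to infinity. -/
structure IsYoungFunction (M : ℝ → ℝ) : Prop where
  even : ∀ t, M (-t) = M t
  convex : ConvexOn ℝ univ M
  continuous : Continuous M
  pos : ∀ t, 0 < t → 0 < M t
  tendsto_div_zero : Tendsto (fun t => M t / t) (𝓝[>] 0) (𝓝 0)
  tendsto_div_atTop : Tendsto (fun t => M t / t) atTop atTop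
  exists_density : ∃ m : ℝ → ℝ,
    (∀ t, 0 ≤ t → 0 ≤ m t) ∧ MonotoneOn m (Ici 0) ∧
    (∀ t, 0 ≤ t → ContinuousWithinAt m (Ici t) t) ∧
    (∀ t, 0 ≤ t → (m t = 0 ↔ t = 0)) ∧ Tendsto m atTop atTop ∧
    ∀ t, M t = ∫ τ in (0 : ℝ)..|t|, m τ

/-- The complementary function `M̄ t = sup {τ |t| - M τ : τ ≥ 0}`. -/
def complementary (M : ℝ → ℝ) (t : ℝ) : ℝ :=
  sSup {r : ℝ | ∃ τ : ℝ, 0 ≤ τ ∧ r = τ * |t| - M τ}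

section Orlicz

variable {U : Type*} [MeasurableSpace U]

/-- The modular `∫ M(u) dμ`, with values in `[0, ∞]`. -/
def modular (M : ℝ → ℝ) (μ : Measure U) (u : U → ℝ) : ENNReal :=
  ∫⁻ x, ENNReal.ofReal (M (u x)) ∂μ

/-- The Orlicz space `L_M(U, dμ)`, as a set of (`μ`-measurable) functions. -/
def orliczSpace (M : ℝ → ℝ) (μ : Measure U) : Set (U → ℝ) :=
  {u | AEStronglyMeasurable u μ ∧ ∃ k : ℝ, 0 < k ∧ modular M μ (fun x => u x / k) < ⊤}

/-- The Luxemburg norm (meaningful on `orliczSpace M μ`). -/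
def luxemburgNorm (M : ℝ → ℝ) (μ : Measure U) (u : U → ℝ) : ℝ :=
  sInf {k : ℝ | 0 < k ∧ modular M μ (fun x => u x / k) ≤ 1}

/-- The space `E_M(U, dμ)`: the closure in `L_M(U, dμ)`, for the Luxemburg norm, of the bounded
measurable functions whose support is bounded and of finite measure. The finiteness of the measure
is automatic if `μ` is finite on bounded sets; in general it ensures that these functions belong
to `L_M(U, dμ)`. -/
def orliczE [Bornology U] (M : ℝ → ℝ) (μ : Measure U) : Set (U → ℝ) :=
  {u | u ∈ orliczSpace M μ ∧ ∀ ε : ℝ, 0 < ε → ∃ v : U → ℝ,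
    AEStronglyMeasurable v μ ∧ (∃ C : ℝ, ∀ x, |v x| ≤ C) ∧
    Bornology.IsBounded (Function.support v) ∧ μ (Function.support v) < ⊤ ∧
    luxemburgNorm M μ (fun x => u x - v x) < ε}

end Orlicz

/-! ### Fractional Orlicz–Sobolev spaces -/

variable {n : ℕ}

/-- The measure `dν_n = dx dy / |x - y| ^ n` on `ℝⁿ × ℝⁿ`. -/
def nu (n : ℕ) : Measure (EuclideanSpace ℝ (Fin n) × EuclideanSpace ℝ (Fin n)) :=
  volume.withDensity fun p => ENNReal.ofReal (1 / ‖p.1 - p.2‖ ^ n)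

/-- The Hölder quotient `Dˢu(x, y) = (u(x) - u(y)) / |x - y| ^ s`. -/
def holderQuotient (s : ℝ) (u : EuclideanSpace ℝ (Fin n) → ℝ) :
    EuclideanSpace ℝ (Fin n) × EuclideanSpace ℝ (Fin n) → ℝ :=
  fun p => (u p.1 - u p.2) / ‖p.1 - p.2‖ ^ s

/-- The space `WˢL_M = {u ∈ L_M : Dˢu ∈ L_M(ν_n)}`. -/
def fracSobolev (s : ℝ) (M : ℝ → ℝ) : Set (EuclideanSpace ℝ (Fin n) → ℝ) :=
  {u | u ∈ orliczSpace M volume ∧ holderQuotient s u ∈ orliczSpace M (nu n)}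

/-- The pairing `∫ f u dx + ∬ F Dˢu dν_n` of `(f, F)` with `u`, where `u` is identified with
the pair `(u, Dˢu)`. -/
def pairing (s : ℝ) (f : EuclideanSpace ℝ (Fin n) → ℝ)
    (F : EuclideanSpace ℝ (Fin n) × EuclideanSpace ℝ (Fin n) → ℝ)
    (u : EuclideanSpace ℝ (Fin n) → ℝ) : ℝ :=
  (∫ x, f x * u x) + ∫ p, F p * holderQuotient s u p ∂(nu n)

/-- The topology `σ(L_M × L_M(ν_n), E_M̄ × E_M̄(ν_n))` on `WˢL_M`: the coarsest topology for which
`u ↦ ∫ f u dx + ∬ F Dˢu dν_n` is continuous for all `f ∈ E_M̄`, `F ∈ E_M̄(ν_n)`. -/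
@[reducible] def sigmaE (n : ℕ) (s : ℝ) (M : ℝ → ℝ) :
    TopologicalSpace (fracSobolev (n := n) s M) :=
  ⨅ f ∈ orliczE (complementary M) (volume : Measure (EuclideanSpace ℝ (Fin n))),
    ⨅ F ∈ orliczE (complementary M) (nu n),
      TopologicalSpace.induced (fun u : fracSobolev (n := n) s M => pairing s f F u.1)
        inferInstance

/-- The space `W₀ˢL_M(Ω)`: the closure of `𝓓(Ω)` in `WˢL_M` for the topology
`σ(L_M × L_M(ν_n), E_M̄ × E_M̄(ν_n))`. -/
def fracSobolevZero (s : ℝ) (M : ℝ → ℝ) (Ω : Opens (EuclideanSpace ℝ (Fin n))) :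
    Set (EuclideanSpace ℝ (Fin n) → ℝ) :=
  Subtype.val '' (@closure (fracSobolev (n := n) s M) (sigmaE n s M)
    {u | ∃ φ : 𝓓(Ω, ℝ), u.1 = φ})

/-! ### The space of distributions `W⁻ˢL_M̄(Ω)` and the weak topology -/

/-- The distribution `T` on `Ω` equals `f + divˢ F`, where the fractional divergence is given by
`⟨divˢ F, φ⟩ = ∬ F Dˢφ dν_n`. -/
def IsRepresentedBy (s : ℝ) {Ω : Opens (EuclideanSpace ℝ (Fin n))} (T : 𝓓'(Ω, ℝ))
    (f : EuclideanSpace ℝ (Fin n) → ℝ)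
    (F : EuclideanSpace ℝ (Fin n) × EuclideanSpace ℝ (Fin n) → ℝ) : Prop :=
  ∀ φ : 𝓓(Ω, ℝ), T φ = pairing s f F φ

/-- The pairs `(f, F)` with `f ∈ L_M̄`, `F ∈ L_M̄(ν_n)` and `T = f + divˢ F` on `Ω`. -/
def representations (s : ℝ) (M : ℝ → ℝ) {Ω : Opens (EuclideanSpace ℝ (Fin n))}
    (T : 𝓓'(Ω, ℝ)) : Set ((EuclideanSpace ℝ (Fin n) → ℝ) ×
      (EuclideanSpace ℝ (Fin n) × EuclideanSpace ℝ (Fin n) → ℝ)) :=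
  {z | z.1 ∈ orliczSpace (complementary M) volume ∧
    z.2 ∈ orliczSpace (complementary M) (nu n) ∧ IsRepresentedBy s T z.1 z.2}

/-- The space `W⁻ˢL_M̄(Ω)` of the distributions `f + divˢ F` on `Ω` with `f ∈ L_M̄` and
`F ∈ L_M̄(ν_n)`. -/
def dualSpace (s : ℝ) (M : ℝ → ℝ) (Ω : Opens (EuclideanSpace ℝ (Fin n))) : Set 𝓓'(Ω, ℝ) :=
  {T | (representations s M T).Nonempty}

/-- The topology `σ(W₀ˢL_M(Ω), W⁻ˢL_M̄(Ω))`: the coarsest topology on `W₀ˢL_M(Ω)` for which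
`u ↦ ⟨T, u⟩ = ∫ f u dx + ∬ F Dˢu dν_n` is continuous for every `T ∈ W⁻ˢL_M̄(Ω)` and every
representation `T = f + divˢ F`. -/
@[reducible] def sigmaL (s : ℝ) (M : ℝ → ℝ) (Ω : Opens (EuclideanSpace ℝ (Fin n))) :
    TopologicalSpace (fracSobolevZero s M Ω) :=
  ⨅ T ∈ dualSpace s M Ω, ⨅ z ∈ representations s M T,
    TopologicalSpace.induced (fun u : fracSobolevZero s M Ω => pairing s z.1 z.2 u.1)
      inferInstance

/-! ### The segment property -/

/-- The segment property: there are a locally finite covering of `∂Ω` by balls of a common radius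
`r` centered on `∂Ω`, unit vectors `e j` and `τ₀ ∈ (0, 1)` such that `x + τ e j ∈ Ω` for all
`x ∈ closure Ω ∩ B_r(c j)` and all `τ ∈ (0, τ₀)`. -/
def SegmentProperty (Ω : Set (EuclideanSpace ℝ (Fin n))) : Prop :=
  ∃ (ι : Type) (c e : ι → EuclideanSpace ℝ (Fin n)) (r τ₀ : ℝ),
    0 < r ∧ 0 < τ₀ ∧ τ₀ < 1 ∧
    (∀ j, c j ∈ frontier Ω) ∧ (∀ j, ‖e j‖ = 1) ∧
    LocallyFinite (fun j => Metric.ball (c j) r) ∧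
    frontier Ω ⊆ ⋃ j, Metric.ball (c j) r ∧
    ∀ j, ∀ x ∈ closure Ω ∩ Metric.ball (c j) r, ∀ τ ∈ Ioo 0 τ₀, x + τ • e j ∈ Ω

end

end FracOrlicz

namespace FracOrlicz

/-! ### Young functions -/

namespace IsYoungFunction

variable {M : ℝ → ℝ} (hM : IsYoungFunction M)
include hM

/-! No Δ₂ condition is assumed, so norm approximation by smooth functions may fail. The substitute
is modular convergence: for one fixed scale `l`, the modulars of `(φ - u) / l` and of the Hölder
quotient of `φ - u`, divided by `l`, can both be made arbitrarily small (`ModularlyApproximable`).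
By Young's inequality this forces convergence of integrals against all of `L_M̄`, not only `E_M̄`
(`exists_abs_integral_mul_le`). If every `u` in `W₀ˢL_M(Ω)` is a modular limit of test functions,
then every pairing with `u` is a limit of values `T φ_k`. This gives independence of the
representation and density at once.

For the modular approximation, `u` vanishes a.e. off `Ω`, a condition that survives the weak closure
(`ae_eq_zero_of_mem_fracSobolevZero`). A partition of unity adapted to the segment property splits
`u` into pieces, which stay in `WˢL_M` because the Hölder quotient of a cut-off is controlled by an
integrable kernel (`mul_mem_fracSobolev`). Each piece is pushed into `Ω` and smoothed by one
convolution (`modularlyApproximable_of_translate`). Jensen's inequality reduces the error to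
modulars of differences of translates, and these are small by continuity of translations in `L¹`,
applied to `M` of the function with its sign restored (`map_half_sub_le`). -/

theorem map_zero : M 0 = 0 := by
  obtain ⟨m, -, -, -, -, -, h⟩ := hM.exists_density
  simpa using h 0

theorem map_abs (t : ℝ) : M |t| = M t := by
  rcases abs_choice t with h | h <;> rw [h]
  exact hM.even t

theorem nonneg (t : ℝ) : 0 ≤ M t := by
  rw [← hM.map_abs]
  rcases (abs_nonneg t).eq_or_lt with h | h
  · rw [← h, hM.map_zero]
  · exact (hM.pos _ h).le

theorem map_mul_le {θ : ℝ} (h0 : 0 ≤ θ) (h1 : θ ≤ 1) (t : ℝ) : M (θ * t) ≤ θ * M t := by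
  have := hM.convex.2 (mem_univ t) (mem_univ 0) h0 (sub_nonneg.2 h1) (by ring)
  simpa [hM.map_zero] using this

theorem mono {a b : ℝ} (h : |a| ≤ |b|) : M a ≤ M b := by
  rw [← hM.map_abs a, ← hM.map_abs b]
  rcases (abs_nonneg b).eq_or_lt with hb | hb
  · have : |a| = 0 := le_antisymm (hb ▸ h) (abs_nonneg a)
    rw [this, hb]
  · have := hM.map_mul_le (div_nonneg (abs_nonneg a) hb.le) ((div_le_one hb).2 h) |b|
    rw [div_mul_cancel₀ _ hb.ne'] at this
    exact this.trans (mul_le_of_le_one_left (hM.nonneg _) ((div_le_one hb).2 h))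

/-- Each summand is a fraction of `a + b`, so convexity with `M 0 = 0` bounds its value by the same
fraction of `M (a + b)`. -/
theorem add_le_map_add {a b : ℝ} (ha : 0 ≤ a) (hb : 0 ≤ b) : M a + M b ≤ M (a + b) := by
  rcases (add_nonneg ha hb).eq_or_lt with h | h
  · have ha' : a = 0 := by linarith
    have hb' : b = 0 := by linarith
    simp [ha', hb', hM.map_zero]
  · have h1 := hM.map_mul_le (div_nonneg ha h.le) ((div_le_one h).2 (by linarith)) (a + b)
    have h2 := hM.map_mul_le (div_nonneg hb h.le) ((div_le_one h).2 (by linarith)) (a + b)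
    rw [div_mul_cancel₀ _ h.ne'] at h1 h2
    have : a / (a + b) * M (a + b) + b / (a + b) * M (a + b) = M (a + b) := by
      field_simp
    linarith

theorem map_add_div_le {a b k l : ℝ} (hk : 0 < k) (hl : 0 < l) :
    M ((a + b) / (k + l)) ≤ k / (k + l) * M (a / k) + l / (k + l) * M (b / l) := by
  have := hM.convex.2 (mem_univ (a / k)) (mem_univ (b / l))
    (by positivity : 0 ≤ k / (k + l)) (by positivity : 0 ≤ l / (k + l)) (by field_simp)
  simp only [smul_eq_mul] at this
  have heq : (a + b) / (k + l) = k / (k + l) * (a / k) + l / (k + l) * (b / l) := by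
    field_simp
  rwa [heq]

end IsYoungFunction

/-- The odd function that agrees with `M` on `[0, ∞)`. -/
noncomputable def oddPart (M : ℝ → ℝ) (t : ℝ) : ℝ := if 0 ≤ t then M t else -M t

namespace IsYoungFunction

variable {M : ℝ → ℝ} (hM : IsYoungFunction M)
include hM

theorem measurable_oddPart : Measurable (oddPart M) :=
  Measurable.ite measurableSet_Ici hM.continuous.measurable hM.continuous.measurable.neg

theorem abs_oddPart (t : ℝ) : |oddPart M t| = M t := by
  unfold oddPart
  split_ifs
  · exact abs_of_nonneg (hM.nonneg t)
  · rw [abs_neg, abs_of_nonneg (hM.nonneg t)]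

theorem map_sub_le_abs_sub {a b : ℝ} (ha : 0 ≤ a) (hb : 0 ≤ b) : M (a - b) ≤ |M a - M b| := by
  rcases le_total b a with h | h
  · have := hM.add_le_map_add (sub_nonneg.2 h) hb
    rw [sub_add_cancel] at this
    exact (le_sub_iff_add_le.2 this).trans (le_abs_self _)
  · have := hM.add_le_map_add (sub_nonneg.2 h) ha
    rw [sub_add_cancel] at this
    rw [← hM.even, neg_sub, abs_sub_comm]
    exact (le_sub_iff_add_le.2 this).trans (le_abs_self _)

/-- For equal signs this is superadditivity of `M` on the half-line. For opposite signs the right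
side is `M a + M b`, and midpoint convexity suffices. It turns `L¹` estimates for `oddPart M ∘ g`
into modular estimates for `g`. -/
theorem map_half_sub_le (a b : ℝ) : M ((a - b) / 2) ≤ |oddPart M a - oddPart M b| := by
  have hhalf : ∀ t, M (t / 2) ≤ M t := fun t => hM.mono (by
    rw [abs_div, abs_two]; linarith [abs_nonneg t])
  have hmid : M ((a - b) / 2) ≤ M a + M b := by
    have h := hM.map_add_div_le (a := a) (b := -b) one_pos one_pos
    norm_num [hM.even, ← sub_eq_add_neg] at h
    linarith [hM.nonneg a, hM.nonneg b]
  unfold oddPart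
  split_ifs with ha hb hb
  · exact (hhalf _).trans (hM.map_sub_le_abs_sub ha hb)
  · rw [sub_neg_eq_add]
    exact hmid.trans (le_abs_self _)
  · refine hmid.trans ?_
    rw [← abs_neg]
    exact (by ring : M a + M b = -(-M a - M b)).le.trans (le_abs_self _)
  · have := hM.map_sub_le_abs_sub (a := -a) (b := -b) (by linarith) (by linarith)
    rw [hM.even, hM.even, neg_sub_neg, ← hM.even, neg_sub] at this
    refine (hhalf _).trans (this.trans_eq ?_)
    rw [← abs_neg]; congr 1; ring

/-! ### The complementary function -/

/-- Superlinear growth of `M` makes `τ|t| - M τ` nonpositive for large `τ`; without boundedness the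
real `sSup` would be a default value. -/
theorem bddAbove_complementary (t : ℝ) :
    BddAbove {r : ℝ | ∃ τ : ℝ, 0 ≤ τ ∧ r = τ * |t| - M τ} := by
  obtain ⟨A, hA⟩ := (tendsto_atTop.1 hM.tendsto_div_atTop |t|).exists_forall_of_atTop
  refine ⟨max A 1 * |t|, ?_⟩
  rintro r ⟨τ, h0, rfl⟩
  rcases le_total τ (max A 1) with h | h
  · nlinarith [hM.nonneg τ, abs_nonneg t, mul_le_mul_of_nonneg_right h (abs_nonneg t)]
  · have hτ : 0 < τ := lt_of_lt_of_le (by positivity) h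
    have := hA τ ((le_max_left _ _).trans h)
    rw [le_div_iff₀ hτ] at this
    have h3 : 0 ≤ max A 1 * |t| := by positivity
    nlinarith

theorem mul_abs_sub_le_complementary {τ : ℝ} (hτ : 0 ≤ τ) (t : ℝ) :
    τ * |t| - M τ ≤ complementary M t :=
  le_csSup (hM.bddAbove_complementary t) ⟨τ, hτ, rfl⟩

omit hM in
theorem complementary_le {t B : ℝ} (h : ∀ τ, 0 ≤ τ → τ * |t| - M τ ≤ B) :
    complementary M t ≤ B := by
  refine csSup_le ⟨_, 0, le_rfl, rfl⟩ ?_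
  rintro r ⟨τ, h0, rfl⟩
  exact h τ h0

theorem complementary_nonneg (t : ℝ) : 0 ≤ complementary M t := by
  simpa [hM.map_zero] using hM.mul_abs_sub_le_complementary le_rfl t

theorem complementary_zero : complementary M 0 = 0 :=
  le_antisymm (complementary_le fun τ _ => by simpa using hM.nonneg τ) (hM.complementary_nonneg 0)

theorem young (a b : ℝ) : |b * a| ≤ complementary M b + M a := by
  have := hM.mul_abs_sub_le_complementary (abs_nonneg a) b
  rw [hM.map_abs] at this
  rw [abs_mul, mul_comm]
  linarith

theorem complementary_mono {a b : ℝ} (h : |a| ≤ |b|) : complementary M a ≤ complementary M b :=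
  complementary_le fun _ hτ =>
    (sub_le_sub_right (mul_le_mul_of_nonneg_left h hτ) _).trans
      (hM.mul_abs_sub_le_complementary hτ b)

theorem complementary_mul_le {θ : ℝ} (h0 : 0 ≤ θ) (h1 : θ ≤ 1) (t : ℝ) :
    complementary M (θ * t) ≤ θ * complementary M t := by
  refine complementary_le fun τ hτ => ?_
  have h := mul_le_mul_of_nonneg_left (hM.mul_abs_sub_le_complementary hτ t) h0
  rw [abs_mul, abs_of_nonneg h0]
  nlinarith [mul_le_of_le_one_left (hM.nonneg τ) h1]

/-- The quotient `M τ / τ` is nondecreasing, so `τ|t| - M τ ≤ 0` once `τ ≥ δ`, and only `τ ≤ δ`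
matters. This is the quantitative form of `M̄(t) = o(t)` at `0`. -/
theorem complementary_le_mul_abs {δ t : ℝ} (hδ : 0 < δ) (ht : |t| ≤ M δ / δ) :
    complementary M t ≤ δ * |t| := by
  refine complementary_le fun τ hτ => ?_
  rcases le_total τ δ with h | h
  · linarith [hM.nonneg τ, mul_le_mul_of_nonneg_right h (abs_nonneg t)]
  · have hτ' : 0 < τ := hδ.trans_le h
    have h1 := hM.map_mul_le (div_nonneg hδ.le hτ) ((div_le_one hτ').2 h) τ
    rw [div_mul_cancel₀ _ hτ'.ne'] at h1
    have h2 : τ * |t| ≤ τ * (M δ / δ) := mul_le_mul_of_nonneg_left ht hτ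
    have h3 : τ * (M δ / δ) ≤ M τ := by
      rw [div_mul_eq_mul_div, le_div_iff₀ hτ'] at h1
      rw [← mul_div_assoc, div_le_iff₀ hδ]
      linarith
    have : 0 ≤ δ * |t| := by positivity
    linarith

theorem tendsto_mul_complementary_div (t : ℝ) :
    Tendsto (fun j : ℕ => ((j : ℝ) + 1) * complementary M (t / ((j : ℝ) + 1))) atTop (𝓝 0) := by
  rw [Metric.tendsto_atTop]
  intro ε hε
  set δ := ε / (|t| + 1) with hδdef
  have hδ : 0 < δ := by positivity
  have hMδ : 0 < M δ / δ := div_pos (hM.pos _ hδ) hδ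
  obtain ⟨N, hN⟩ := exists_nat_gt (|t| / (M δ / δ))
  refine ⟨N, fun j hj => ?_⟩
  have hj' : (0 : ℝ) < (j : ℝ) + 1 := by positivity
  have hs : |t / ((j : ℝ) + 1)| ≤ M δ / δ := by
    rw [abs_div, abs_of_pos hj', div_le_iff₀ hj']
    rw [div_lt_iff₀ hMδ] at hN
    have : (N : ℝ) ≤ j := by exact_mod_cast hj
    nlinarith
  have h := hM.complementary_le_mul_abs hδ hs
  rw [Real.dist_0_eq_abs, abs_of_nonneg (mul_nonneg hj'.le (hM.complementary_nonneg _))]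
  calc _ ≤ ((j : ℝ) + 1) * (δ * |t / ((j : ℝ) + 1)|) := mul_le_mul_of_nonneg_left h hj'.le
    _ = δ * |t| := by rw [abs_div, abs_of_pos hj']; field_simp
    _ < ε := by
      rw [hδdef, div_mul_eq_mul_div, div_lt_iff₀ (by positivity)]
      nlinarith

theorem measurable_complementary : Measurable (complementary M) := by
  have h1 : Monotone fun t : ℝ => complementary M (max t 0) := fun a b h =>
    hM.complementary_mono (by
      rw [abs_of_nonneg (le_max_right _ _), abs_of_nonneg (le_max_right _ _)]
      exact max_le_max_right 0 h)
  have h2 : complementary M = (fun t : ℝ => complementary M (max t 0)) ∘ fun t => |t| := by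
    ext t
    simp [complementary]
  rw [h2]
  exact h1.measurable.comp continuous_abs.measurable

end IsYoungFunction

/-! ### Orlicz spaces -/

section Orlicz

variable {U : Type*} [MeasurableSpace U] {μ : Measure U} {M : ℝ → ℝ}

namespace IsYoungFunction

variable (hM : IsYoungFunction M)
include hM

theorem modular_mono {u v : U → ℝ} (h : ∀ᵐ x ∂μ, |u x| ≤ |v x|) :
    modular M μ u ≤ modular M μ v :=
  lintegral_mono_ae <| h.mono fun _ hx => ENNReal.ofReal_le_ofReal (hM.mono hx)

theorem modular_div_anti {u : U → ℝ} {k l : ℝ} (hk : 0 < k) (h : k ≤ l) :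
    modular M μ (fun x => u x / l) ≤ modular M μ fun x => u x / k :=
  hM.modular_mono <| .of_forall fun x => by
    rw [abs_div, abs_div, abs_of_pos hk, abs_of_pos (hk.trans_le h)]
    exact div_le_div_of_nonneg_left (abs_nonneg _) hk h

/-- The quotient is a convex combination of `u / k` and `v / l`. Scales add while the bound `ε` is
preserved, so finite sums keep a scale independent of `ε`. -/
theorem modular_add_div_le {u v : U → ℝ} {k l : ℝ} {ε : ENNReal} (hu : AEStronglyMeasurable u μ)
    (hk : 0 < k) (hl : 0 < l) (h1 : modular M μ (fun x => u x / k) ≤ ε)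
    (h2 : modular M μ (fun x => v x / l) ≤ ε) :
    modular M μ (fun x => (u x + v x) / (k + l)) ≤ ε := by
  have hkl : 0 < k + l := add_pos hk hl
  calc modular M μ (fun x => (u x + v x) / (k + l))
      ≤ ∫⁻ x, ENNReal.ofReal (k / (k + l)) * ENNReal.ofReal (M (u x / k)) +
          ENNReal.ofReal (l / (k + l)) * ENNReal.ofReal (M (v x / l)) ∂μ := by
        refine lintegral_mono fun x => ?_
        rw [← ENNReal.ofReal_mul (by positivity), ← ENNReal.ofReal_mul (by positivity),
          ← ENNReal.ofReal_add (mul_nonneg (by positivity) (hM.nonneg _))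
            (mul_nonneg (by positivity) (hM.nonneg _))]
        exact ENNReal.ofReal_le_ofReal (hM.map_add_div_le hk hl)
    _ = ENNReal.ofReal (k / (k + l)) * modular M μ (fun x => u x / k) +
          ENNReal.ofReal (l / (k + l)) * modular M μ (fun x => v x / l) := by
        rw [lintegral_add_left', lintegral_const_mul' _ _ ENNReal.ofReal_ne_top,
          lintegral_const_mul' _ _ ENNReal.ofReal_ne_top]
        · rfl
        · exact ((hM.continuous.measurable.comp_aemeasurable
            (hu.aemeasurable.div_const k)).ennreal_ofReal).const_mul _
    _ ≤ ENNReal.ofReal (k / (k + l)) * ε + ENNReal.ofReal (l / (k + l)) * ε := by gcongr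
    _ = ε := by
        rw [← add_mul, ← ENNReal.ofReal_add (by positivity) (by positivity), ← add_div,
          div_self hkl.ne', ENNReal.ofReal_one, one_mul]

theorem orliczSpace_mono {u v : U → ℝ} (hv : v ∈ orliczSpace M μ) (hu : AEStronglyMeasurable u μ)
    (h : ∀ᵐ x ∂μ, |u x| ≤ |v x|) : u ∈ orliczSpace M μ := by
  obtain ⟨-, k, hk, hv⟩ := hv
  refine ⟨hu, k, hk, (hM.modular_mono (h.mono fun x hx => ?_)).trans_lt hv⟩
  rw [abs_div, abs_div]
  gcongr

theorem orliczSpace_add {u v : U → ℝ} (hu : u ∈ orliczSpace M μ) (hv : v ∈ orliczSpace M μ) :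
    (fun x => u x + v x) ∈ orliczSpace M μ := by
  obtain ⟨hum, k, hk, hu⟩ := hu
  obtain ⟨hvm, l, hl, hv⟩ := hv
  exact ⟨hum.add hvm, k + l, add_pos hk hl, (hM.modular_add_div_le hum hk hl
    (le_max_left _ _) (le_max_right _ _)).trans_lt (max_lt hu hv)⟩

theorem orliczSpace_const_mul {u : U → ℝ} (hu : u ∈ orliczSpace M μ) (c : ℝ) :
    (fun x => c * u x) ∈ orliczSpace M μ := by
  obtain ⟨hum, k, hk, hu⟩ := hu
  refine ⟨hum.const_mul c, (|c| + 1) * k, by positivity,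
    (hM.modular_mono (.of_forall fun x => ?_)).trans_lt hu⟩
  rw [abs_div, abs_div, abs_mul, abs_of_pos hk, abs_of_pos (by positivity : 0 < (|c| + 1) * k),
    mul_div_mul_comm]
  exact mul_le_of_le_one_left (by positivity) ((div_le_one (by positivity)).2 (by linarith))

theorem integrable_of_modular_lt_top {u : U → ℝ} {k : ℝ} (hu : AEStronglyMeasurable u μ)
    (h : modular M μ (fun x => u x / k) < ⊤) : Integrable (fun x => M (u x / k)) μ :=
  ⟨(hM.continuous.measurable.comp_aemeasurable
      (hu.aemeasurable.div_const k)).aestronglyMeasurable, by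
    rwa [hasFiniteIntegral_iff_ofReal (.of_forall fun x => hM.nonneg _)]⟩

theorem integrable_of_modular_complementary_lt_top {f : U → ℝ} {k : ℝ}
    (hf : AEStronglyMeasurable f μ) (h : modular (complementary M) μ (fun x => f x / k) < ⊤) :
    Integrable (fun x => complementary M (f x / k)) μ :=
  ⟨(hM.measurable_complementary.comp_aemeasurable
      (hf.aemeasurable.div_const k)).aestronglyMeasurable, by
    rwa [hasFiniteIntegral_iff_ofReal (.of_forall fun x => hM.complementary_nonneg _)]⟩

theorem integrable_mul {f u : U → ℝ} (hf : f ∈ orliczSpace (complementary M) μ)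
    (hu : u ∈ orliczSpace M μ) : Integrable (fun x => f x * u x) μ := by
  obtain ⟨hfm, k, hk, hf⟩ := hf
  obtain ⟨hum, l, hl, hu⟩ := hu
  refine Integrable.mono' (((hM.integrable_of_modular_complementary_lt_top hfm hf).add
    (hM.integrable_of_modular_lt_top hum hu)).const_mul (k * l)) (hfm.mul hum)
    (.of_forall fun x => ?_)
  have h := mul_le_mul_of_nonneg_left (hM.young (u x / l) (f x / k)) (mul_pos hk hl).le
  rw [Real.norm_eq_abs]
  refine le_trans (le_of_eq ?_) h
  rw [← abs_of_pos (mul_pos hk hl), ← abs_mul]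
  congr 1
  field_simp

/-- Modular convergence to `0` implies weak convergence against the complementary Orlicz space. -/
theorem exists_abs_integral_mul_le {f : U → ℝ} (hf : f ∈ orliczSpace (complementary M) μ)
    {l : ℝ} (hl : 0 < l) {ε : ℝ} (hε : 0 < ε) :
    ∃ δ : ℝ, 0 < δ ∧ ∀ w : U → ℝ, AEStronglyMeasurable w μ →
      modular M μ (fun x => w x / l) ≤ ENNReal.ofReal δ → |∫ x, f x * w x ∂μ| ≤ ε := by
  obtain ⟨hfm, k, hk, hf⟩ := hf
  have hfi := hM.integrable_of_modular_complementary_lt_top hfm hf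
  have hcomp : ∀ (j : ℕ) t, ((j : ℝ) + 1) * complementary M (t / ((j : ℝ) + 1)) ≤
      complementary M t := fun j t => by
    have hj : (0 : ℝ) < (j : ℝ) + 1 := by positivity
    have := hM.complementary_mul_le (inv_nonneg.2 hj.le)
      (inv_le_one_of_one_le₀ (by linarith [(Nat.cast_nonneg j : (0 : ℝ) ≤ j)])) t
    rw [inv_mul_eq_div, inv_mul_eq_div, le_div_iff₀ hj] at this
    linarith
  have hlim : Tendsto (fun j : ℕ => ∫ x, ((j : ℝ) + 1) *
      complementary M (f x / k / ((j : ℝ) + 1)) ∂μ) atTop (𝓝 0) := by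
    rw [← integral_zero U ℝ (μ := μ)]
    refine tendsto_integral_of_dominated_convergence _ (fun j => ?_) hfi (fun j => ?_)
      (.of_forall fun x => hM.tendsto_mul_complementary_div (f x / k))
    · exact (hM.measurable_complementary.comp_aemeasurable ((hfm.aemeasurable.div_const k).div_const
        ((j : ℝ) + 1))).aestronglyMeasurable.const_mul _
    · refine .of_forall fun x => ?_
      rw [Real.norm_of_nonneg (mul_nonneg (by positivity) (hM.complementary_nonneg _))]
      exact hcomp j _
  -- Young's inequality is applied to `f / (k(j+1))` and `w / l`. First `j` is fixed to make the
  -- `M̄` term small; then `δ` absorbs the factor `j + 1` that multiplies the modular of `w`.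
  obtain ⟨j, hj⟩ := (hlim.eventually_lt_const (u := ε / 2 / (k * l)) (by positivity)).exists
  have hj0 : (0 : ℝ) < (j : ℝ) + 1 := by positivity
  refine ⟨ε / 2 / (k * l * ((j : ℝ) + 1)), by positivity, fun w hw hmod => ?_⟩
  have hwi := hM.integrable_of_modular_lt_top hw (hmod.trans_lt ENNReal.ofReal_lt_top)
  have hfi' : Integrable (fun x => complementary M (f x / k / ((j : ℝ) + 1))) μ := by
    refine Integrable.mono' hfi ((hM.measurable_complementary.comp_aemeasurable
      ((hfm.aemeasurable.div_const k).div_const ((j : ℝ) + 1))).aestronglyMeasurable)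
      (.of_forall fun x => ?_)
    rw [Real.norm_of_nonneg (hM.complementary_nonneg _)]
    refine le_trans ?_ (hcomp j _)
    exact le_mul_of_one_le_left (hM.complementary_nonneg _)
      (by linarith [(Nat.cast_nonneg j : (0 : ℝ) ≤ j)])
  have hw2 : ∫ x, M (w x / l) ∂μ ≤ ε / 2 / (k * l * ((j : ℝ) + 1)) := by
    rw [integral_eq_lintegral_of_nonneg_ae (.of_forall fun x => hM.nonneg _) hwi.1]
    exact ENNReal.toReal_le_of_le_ofReal (by positivity) hmod
  have hpt : ∀ x, ‖f x * w x‖ ≤ k * l * (((j : ℝ) + 1) *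
      complementary M (f x / k / ((j : ℝ) + 1))) + k * l * ((j : ℝ) + 1) * M (w x / l) := by
    intro x
    have hc : (0 : ℝ) < k * l * ((j : ℝ) + 1) := by positivity
    have h := mul_le_mul_of_nonneg_left (hM.young (w x / l) (f x / k / ((j : ℝ) + 1))) hc.le
    rw [Real.norm_eq_abs]
    refine le_trans (le_of_eq ?_) (h.trans_eq (by ring))
    rw [← abs_of_pos hc, ← abs_mul]
    congr 1
    field_simp
  calc |∫ x, f x * w x ∂μ|
      ≤ ∫ x, k * l * (((j : ℝ) + 1) * complementary M (f x / k / ((j : ℝ) + 1))) +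
          k * l * ((j : ℝ) + 1) * M (w x / l) ∂μ :=
        norm_integral_le_of_norm_le (((hfi'.const_mul _).const_mul _).add (hwi.const_mul _))
          (.of_forall hpt)
    _ = k * l * ∫ x, ((j : ℝ) + 1) * complementary M (f x / k / ((j : ℝ) + 1)) ∂μ +
          k * l * ((j : ℝ) + 1) * ∫ x, M (w x / l) ∂μ := by
        rw [integral_add ((hfi'.const_mul _).const_mul _) (hwi.const_mul _), integral_const_mul,
          integral_const_mul (k * l * ((j : ℝ) + 1))]
    _ ≤ k * l * (ε / 2 / (k * l)) + k * l * ((j : ℝ) + 1) *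
          (ε / 2 / (k * l * ((j : ℝ) + 1))) := by gcongr
    _ = ε := by field_simp; ring

end IsYoungFunction

/-- Jensen's inequality for the modular. -/
theorem IsYoungFunction.modular_integral_le {V : Type*} [MeasurableSpace V] [SFinite μ]
    (hM : IsYoungFunction M) (π : Measure V) [IsProbabilityMeasure π] {G : V → U → ℝ}
    (hG : Measurable (Function.uncurry G)) :
    modular M μ (fun x => ∫ h, G h x ∂π) ≤ ∫⁻ h, modular M μ (G h) ∂π := by
  have jensen : ∀ w : V → ℝ, Measurable w →
      ENNReal.ofReal (M (∫ h, w h ∂π)) ≤ ∫⁻ h, ENNReal.ofReal (M (w h)) ∂π := by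
    intro w hw
    by_cases hi : Integrable w π
    swap
    -- Without integrability the Bochner integral is `0`, and `M 0 = 0`.
    · simp [integral_undef hi, hM.map_zero]
    by_cases htop : ∫⁻ h, ENNReal.ofReal (M (w h)) ∂π = ⊤
    · simp [htop]
    have hMi : Integrable (fun h => M (w h)) π :=
      ⟨(hM.continuous.measurable.comp hw).aestronglyMeasurable, by
        rw [hasFiniteIntegral_iff_ofReal (.of_forall fun x => hM.nonneg _)]
        exact lt_top_iff_ne_top.2 htop⟩
    rw [← ofReal_integral_eq_lintegral_ofReal hMi (.of_forall fun x => hM.nonneg _)]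
    exact ENNReal.ofReal_le_ofReal (hM.convex.map_integral_le hM.continuous.continuousOn
      isClosed_univ (.of_forall fun _ => mem_univ _) hi hMi)
  calc modular M μ (fun x => ∫ h, G h x ∂π)
      ≤ ∫⁻ x, ∫⁻ h, ENNReal.ofReal (M (G h x)) ∂π ∂μ :=
        lintegral_mono fun x => jensen _ (hG.comp measurable_prodMk_right)
    _ = ∫⁻ h, modular M μ (G h) ∂π := by
        rw [lintegral_lintegral_swap]
        · rfl
        · exact ((hM.continuous.measurable.comp (hG.comp measurable_swap)).ennreal_ofReal).aemeasurable

end Orlicz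

end FracOrlicz

namespace FracOrlicz

/-! ### Continuity of translations -/

section Translation

variable {E : Type*} [NormedAddCommGroup E] [NormedSpace ℝ E] [FiniteDimensional ℝ E]
  [MeasureSpace E] [BorelSpace E] [(volume : Measure E).IsAddHaarMeasure]

/-- Translations act continuously on `L¹`; the rest identifies the distance in `L¹` with the
integral. -/
theorem tendsto_lintegral_enorm_translate_sub {G : E → ℝ} (hG : Integrable G) :
    Tendsto (fun h : E => ∫⁻ x, ‖G (x - h) - G x‖ₑ) (𝓝 0) (𝓝 0) := by
  have hG1 : MemLp G 1 := memLp_one_iff_integrable.2 hG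
  have : Fact ((1 : ENNReal) ≠ ⊤) := ⟨ENNReal.one_ne_top⟩
  have hcont : Continuous fun h : E => (DomAddAct.mk (-h) +ᵥ hG1.toLp G : Lp ℝ 1 volume) :=
    (DomAddAct.continuous_mk.comp continuous_neg).vadd continuous_const
  have hlim := (tendsto_iff_edist_tendsto_0.1 (hcont.tendsto 0))
  refine hlim.congr fun h => ?_
  rw [neg_zero, DomAddAct.mk_zero, zero_vadd, Lp.edist_def, eLpNorm_one_eq_lintegral_enorm]
  refine lintegral_congr_ae ?_
  have h1 := DomAddAct.vadd_Lp_ae_eq (DomAddAct.mk (-h)) (hG1.toLp G)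
  have h2 := (measurePreserving_vadd (-h) (volume : Measure E)).quasiMeasurePreserving.ae_eq_comp
    hG1.coeFn_toLp
  filter_upwards [h1, h2, hG1.coeFn_toLp] with x hx1 hx2 hx3
  simp only [Function.comp_apply, Equiv.symm_apply_apply] at hx1 hx2
  rw [Pi.sub_apply, hx1, hx2, hx3, vadd_eq_add, neg_add_eq_sub]

variable {M : ℝ → ℝ}

/-- `L¹` continuity is applied to `w * oddPart M (g / k)`; invariance of `w` under the shift lets it
factor out, and the `2` in the scale comes from `map_half_sub_le`. The weight `1` gives Lebesgue
measure, and `|x - y|⁻ⁿ`, invariant under diagonal shifts, gives `ν_n`. -/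
theorem IsYoungFunction.exists_modular_translate_sub_le (hM : IsYoungFunction M) {w g : E → ℝ}
    (hw : Measurable w) (hw0 : ∀ x, 0 ≤ w x) (hg : Measurable g) {k : ℝ}
    (hgk : modular M (volume.withDensity fun x => ENNReal.ofReal (w x)) (fun x => g x / k) < ⊤)
    {ε : ℝ} (hε : 0 < ε) :
    ∃ δ : ℝ, 0 < δ ∧ ∀ h : E, ‖h‖ < δ → (∀ x, w (x - h) = w x) →
      modular M (volume.withDensity fun x => ENNReal.ofReal (w x))
        (fun x => (g (x - h) - g x) / (2 * k)) ≤ ENNReal.ofReal ε := by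
  have hmod : ∀ f : E → ℝ, Measurable f →
      modular M (volume.withDensity fun x => ENNReal.ofReal (w x)) f =
        ∫⁻ x, ENNReal.ofReal (w x * M (f x)) := fun f hf => by
    refine (lintegral_withDensity_eq_lintegral_mul _ hw.ennreal_ofReal
      (hM.continuous.measurable.comp hf).ennreal_ofReal).trans ?_
    exact lintegral_congr fun x => (ENNReal.ofReal_mul (hw0 x)).symm
  set G : E → ℝ := fun x => w x * oddPart M (g x / k) with hGdef
  have hGm : Measurable G := hw.mul (hM.measurable_oddPart.comp (hg.div_const k))
  have hG : Integrable G := by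
    refine ⟨hGm.aestronglyMeasurable, ?_⟩
    rw [hmod _ (hg.div_const k)] at hgk
    rw [hasFiniteIntegral_iff_norm]
    refine lt_of_le_of_lt (lintegral_mono fun x => ENNReal.ofReal_le_ofReal ?_) hgk
    rw [hGdef, Real.norm_eq_abs, abs_mul, hM.abs_oddPart, abs_of_nonneg (hw0 x)]
  have hev := (tendsto_lintegral_enorm_translate_sub hG).eventually_lt_const
    (ENNReal.ofReal_pos.2 hε)
  obtain ⟨δ, hδ, hball⟩ := Metric.eventually_nhds_iff.1 hev
  refine ⟨δ, hδ, fun h hh hwh => ?_⟩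
  rw [hmod _ (by fun_prop)]
  refine le_trans (lintegral_mono fun x => ?_) (hball (by rwa [dist_zero_right])).le
  rw [← ofReal_norm]
  refine ENNReal.ofReal_le_ofReal ?_
  simp only [hGdef]
  rw [hwh x, ← mul_sub, Real.norm_eq_abs, abs_mul, abs_of_nonneg (hw0 x)]
  refine mul_le_mul_of_nonneg_left ?_ (hw0 x)
  have := hM.map_half_sub_le (g (x - h) / k) (g x / k)
  rwa [← sub_div, div_div, mul_comm k 2] at this

end Translation

/-! ### Functions with bounded range and support of finite measure -/

section Bounded

variable {U : Type*} [MeasurableSpace U] {μ : Measure U} {M : ℝ → ℝ}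

theorem modular_lt_top_of_bounded {f : U → ℝ} (h0 : M 0 = 0) {C : ℝ}
    (hC : ∀ x, M (f x) ≤ C) (hs : μ (Function.support f) < ⊤) : modular M μ f < ⊤ := by
  calc modular M μ f
      ≤ ∫⁻ x, (toMeasurable μ (Function.support f)).indicator (fun _ => ENNReal.ofReal C) x ∂μ := by
        refine lintegral_mono fun x => ?_
        by_cases hx : f x = 0
        · simp [hx, h0]
        · rw [indicator_of_mem (subset_toMeasurable _ _ hx)]
          exact ENNReal.ofReal_le_ofReal (hC x)
    _ < ⊤ := by
        rw [lintegral_indicator (measurableSet_toMeasurable _ _), setLIntegral_const,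
          measure_toMeasurable]
        exact ENNReal.mul_lt_top ENNReal.ofReal_lt_top hs

namespace IsYoungFunction

variable (hM : IsYoungFunction M)
include hM

theorem mem_orliczSpace_of_bounded {f : U → ℝ} (hf : AEStronglyMeasurable f μ) {C : ℝ}
    (hC : ∀ x, |f x| ≤ C) (hs : μ (Function.support f) < ⊤) : f ∈ orliczSpace M μ :=
  ⟨hf, 1, one_pos, by
    simp only [div_one]
    exact modular_lt_top_of_bounded hM.map_zero
      (fun x => hM.mono ((hC x).trans (le_abs_self C))) hs⟩

theorem mem_orliczSpace_complementary_of_bounded {f : U → ℝ} (hf : AEStronglyMeasurable f μ)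
    {C : ℝ} (hC : ∀ x, |f x| ≤ C) (hs : μ (Function.support f) < ⊤) :
    f ∈ orliczSpace (complementary M) μ :=
  ⟨hf, 1, one_pos, by
    simp only [div_one]
    exact modular_lt_top_of_bounded hM.complementary_zero
      (fun x => hM.complementary_mono ((hC x).trans (le_abs_self C))) hs⟩

theorem mem_orliczE_complementary_of_bounded [Bornology U] {f : U → ℝ}
    (hf : AEStronglyMeasurable f μ) {C : ℝ} (hC : ∀ x, |f x| ≤ C)
    (hb : Bornology.IsBounded (Function.support f)) (hs : μ (Function.support f) < ⊤) :
    f ∈ orliczE (complementary M) μ := by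
  refine ⟨hM.mem_orliczSpace_complementary_of_bounded hf hC hs, fun ε hε =>
    ⟨f, hf, ⟨C, hC⟩, hb, hs, ?_⟩⟩
  -- The function approximates itself, and every positive `k` is admissible for the zero difference.
  refine lt_of_le_of_lt (csInf_le (a := ε / 2) ⟨0, fun k hk => hk.1.le⟩ ?_) (half_lt_self hε)
  refine ⟨half_pos hε, ?_⟩
  simp [modular, hM.complementary_zero]

end IsYoungFunction

end Bounded

/-! ### The measure `ν_n` and Hölder quotients -/

variable {n : ℕ} {s : ℝ} {M : ℝ → ℝ}

theorem measurable_nu_weight : Measurable fun p : EuclideanSpace ℝ (Fin n) ×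
    EuclideanSpace ℝ (Fin n) => 1 / ‖p.1 - p.2‖ ^ n := by fun_prop

instance : (volume : Measure (EuclideanSpace ℝ (Fin n) ×
    EuclideanSpace ℝ (Fin n))).IsAddHaarMeasure :=
  Measure.prod.instIsAddHaarMeasure volume volume

instance : SFinite (nu n) := by unfold nu; infer_instance

theorem nu_absolutelyContinuous : nu n ≪ volume := withDensity_absolutelyContinuous _ _

theorem measurable_holderQuotient {u : EuclideanSpace ℝ (Fin n) → ℝ} (hu : Measurable u) :
    Measurable (holderQuotient s u) := by
  unfold holderQuotient
  fun_prop

theorem holderQuotient_congr_ae {u v : EuclideanSpace ℝ (Fin n) → ℝ} (h : u =ᵐ[volume] v) :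
    holderQuotient s u =ᵐ[nu n] holderQuotient s v := by
  refine nu_absolutelyContinuous.ae_le ?_
  filter_upwards [Measure.quasiMeasurePreserving_fst.ae h,
    Measure.quasiMeasurePreserving_snd.ae h] with p h1 h2
  simp only [holderQuotient, h1, h2]

/-! ### Modular approximation by test functions -/

/-- The function `u` is approximated by test functions on `Ω` in the sense of modular
convergence of the functions and of their Hölder quotients. -/
def ModularlyApproximable (s : ℝ) (M : ℝ → ℝ) (Ω : Opens (EuclideanSpace ℝ (Fin n)))
    (u : EuclideanSpace ℝ (Fin n) → ℝ) : Prop :=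
  ∃ l : ℝ, 0 < l ∧ ∀ ε : ℝ, 0 < ε → ∃ φ : 𝓓(Ω, ℝ),
    modular M volume (fun x => (φ x - u x) / l) ≤ ENNReal.ofReal ε ∧
    modular M (nu n) (fun p => (holderQuotient s φ p - holderQuotient s u p) / l) ≤
      ENNReal.ofReal ε

variable {Ω : Opens (EuclideanSpace ℝ (Fin n))}

theorem ModularlyApproximable.zero (hM : IsYoungFunction M) :
    ModularlyApproximable s M Ω fun _ => 0 :=
  ⟨1, one_pos, fun ε _ => ⟨0, by simp [modular, hM.map_zero],
    by simp [modular, hM.map_zero, holderQuotient]⟩⟩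

theorem ModularlyApproximable.add (hM : IsYoungFunction M) {u v : EuclideanSpace ℝ (Fin n) → ℝ}
    (hum : Measurable u)
    (hu : ModularlyApproximable s M Ω u) (hv : ModularlyApproximable s M Ω v) :
    ModularlyApproximable s M Ω fun x => u x + v x := by
  obtain ⟨k, hk, hu⟩ := hu
  obtain ⟨l, hl, hv⟩ := hv
  refine ⟨k + l, add_pos hk hl, fun ε hε => ?_⟩
  obtain ⟨φ, h1, h2⟩ := hu ε hε
  obtain ⟨ψ, h3, h4⟩ := hv ε hε
  have hφ : Measurable φ := φ.continuous.measurable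
  refine ⟨φ + ψ, ?_, ?_⟩
  · refine le_trans (le_of_eq ?_)
      (hM.modular_add_div_le (hφ.sub hum).aestronglyMeasurable hk hl h1 h3)
    congr 1; ext x
    simp only [FunLike.coe_add, Pi.add_apply, Pi.sub_apply]
    ring
  · refine le_trans (le_of_eq ?_) (hM.modular_add_div_le ((measurable_holderQuotient hφ).sub
      (measurable_holderQuotient hum)).aestronglyMeasurable hk hl h2 h4)
    congr 1; ext p
    simp only [holderQuotient, FunLike.coe_add, Pi.add_apply, Pi.sub_apply]
    ring

theorem ModularlyApproximable.sum (hM : IsYoungFunction M) {ι : Type*} (J : Finset ι)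
    {u : ι → EuclideanSpace ℝ (Fin n) → ℝ} (hum : ∀ i ∈ J, Measurable (u i))
    (hu : ∀ i ∈ J, ModularlyApproximable s M Ω (u i)) :
    ModularlyApproximable s M Ω fun x => ∑ i ∈ J, u i x := by
  classical
  induction J using Finset.induction_on with
  | empty => simpa using ModularlyApproximable.zero hM
  | insert i J hi ih =>
    simp only [Finset.sum_insert hi]
    exact (hu i (Finset.mem_insert_self _ _)).add hM (hum i (Finset.mem_insert_self _ _))
      (ih (fun j hj => hum j (Finset.mem_insert_of_mem hj))
        fun j hj => hu j (Finset.mem_insert_of_mem hj))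

open Pointwise in
-- Convolution with a bump centred at the small vector `a` translates and mollifies simultaneously,
-- so the support lands near `K + a`, inside `Ω`. The result averages the translates of `v` over a
-- probability measure, so Jensen bounds the error by modulars of `v(· - t) - v` for small `t`.
theorem IsYoungFunction.modularlyApproximable_of_translate (hM : IsYoungFunction M)
    {v : EuclideanSpace ℝ (Fin n) → ℝ} (hvm : Measurable v) (hv : v ∈ fracSobolev s M)
    {K : Set (EuclideanSpace ℝ (Fin n))} (hK : IsCompact K) (hvK : ∀ x, x ∉ K → v x = 0)
    (htrans : ∀ δ : ℝ, 0 < δ → ∃ a : EuclideanSpace ℝ (Fin n), ‖a‖ < δ ∧ ∀ x ∈ K, x + a ∈ Ω) :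
    ModularlyApproximable s M Ω v := by
  obtain ⟨⟨-, k₁, hk₁, hv₁⟩, -, k₂, hk₂, hv₂⟩ := hv
  set k := max k₁ k₂
  have hk : 0 < k := hk₁.trans_le (le_max_left _ _)
  replace hv₁ := (hM.modular_div_anti hk₁ (le_max_left k₁ k₂)).trans_lt hv₁
  replace hv₂ := (hM.modular_div_anti hk₂ (le_max_right k₁ k₂)).trans_lt hv₂
  -- The indicator of `K` lies in `L_M̄`, and `v` is its product with that indicator.
  have hvi : Integrable v := by
    have h1 : K.indicator (fun _ => (1 : ℝ)) ∈ orliczSpace (complementary M) volume :=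
      hM.mem_orliczSpace_complementary_of_bounded
        (measurable_const.indicator hK.measurableSet).aestronglyMeasurable (C := 1)
        (fun x => by by_cases hx : x ∈ K <;> simp [hx])
        ((measure_mono support_indicator_subset).trans_lt hK.measure_lt_top)
    refine (hM.integrable_mul h1 ⟨hvm.aestronglyMeasurable, k, hk, hv₁⟩).congr
      (.of_forall fun x => ?_)
    by_cases hx : x ∈ K <;> simp [hx, hvK x]
  have hvol : (volume : Measure (EuclideanSpace ℝ (Fin n))).withDensity
      (fun _ => ENNReal.ofReal 1) = volume := by
    simp
  refine ⟨2 * k, by positivity, fun ε hε => ?_⟩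
  obtain ⟨δ₁, hδ₁, h1⟩ := hM.exists_modular_translate_sub_le (w := fun _ => 1) (k := k)
    measurable_const (fun _ => zero_le_one) hvm (by rwa [hvol]) hε
  rw [hvol] at h1
  obtain ⟨δ₂, hδ₂, h2⟩ := hM.exists_modular_translate_sub_le (k := k) measurable_nu_weight
    (fun p => by positivity) (measurable_holderQuotient hvm) hv₂ hε
  set δ := min δ₁ δ₂
  have hδ : 0 < δ := lt_min hδ₁ hδ₂
  obtain ⟨a, haδ, haK⟩ := htrans (δ / 2) (half_pos hδ)
  have hKa : IsCompact ((fun x => x + a) '' K) := hK.image (continuous_add_const a)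
  obtain ⟨r, hr, hrΩ⟩ := hKa.exists_cthickening_subset_open Ω.isOpen
    (by rintro _ ⟨x, hx, rfl⟩; exact haK x hx)
  -- Radius at most `r` keeps the support in `Ω`; radius at most `δ / 2`, with `‖a‖ < δ / 2`, keeps
  -- all shifts shorter than `δ`.
  let ρ : ContDiffBump a := ⟨min r (δ / 2) / 2, min r (δ / 2), by positivity,
    half_lt_self (by positivity)⟩
  have hρδ : ∀ t, ρ.normed volume t ≠ 0 → ‖t‖ < δ := fun t ht => by
    have : t ∈ Metric.ball a ρ.rOut := by rw [← ρ.support_normed_eq (μ := volume)]; exact ht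
    have h3 : dist t a < δ / 2 := (Metric.mem_ball.1 this).trans_le (min_le_right _ _)
    rw [dist_eq_norm] at h3
    linarith [norm_sub_norm_le t a]
  let π : Measure (EuclideanSpace ℝ (Fin n)) :=
    volume.withDensity fun t => ENNReal.ofReal (ρ.normed volume t)
  have hρm : Measurable (ρ.normed volume) := ρ.continuous_normed.measurable
  have hπ : IsProbabilityMeasure π := ⟨by
    rw [withDensity_apply _ .univ, Measure.restrict_univ,
      ← ofReal_integral_eq_lintegral_ofReal ρ.integrable_normed
        (.of_forall fun t => ρ.nonneg_normed t), ρ.integral_normed, ENNReal.ofReal_one]⟩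
  have hπint : ∀ f : EuclideanSpace ℝ (Fin n) → ℝ,
      ∫ t, f t ∂π = ∫ t, ρ.normed volume t * f t := fun f => by
    rw [integral_withDensity_eq_integral_toReal_smul hρm.ennreal_ofReal
      (.of_forall fun _ => ENNReal.ofReal_lt_top)]
    simp only [ENNReal.toReal_ofReal (ρ.nonneg_normed _), smul_eq_mul]
  have hvπ : ∀ x, Integrable (fun t => v (x - t)) π := fun x => by
    rw [integrable_withDensity_iff_integrable_smul' hρm.ennreal_ofReal
      (.of_forall fun _ => ENNReal.ofReal_lt_top)]
    simp only [ENNReal.toReal_ofReal (ρ.nonneg_normed _)]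
    exact ρ.hasCompactSupport_normed.convolutionExists_left (ContinuousLinearMap.lsmul ℝ ℝ)
      ρ.continuous_normed hvi.locallyIntegrable x
  let ψ : EuclideanSpace ℝ (Fin n) → ℝ :=
    convolution (ρ.normed volume) v (ContinuousLinearMap.lsmul ℝ ℝ) volume
  have hψ : ∀ x, ψ x = ∫ t, v (x - t) ∂π := fun x => by
    rw [hπint]; rfl
  have hsupp : tsupport ψ ⊆ Metric.cthickening r ((fun x => x + a) '' K) := by
    refine closure_minimal ?_ Metric.isClosed_cthickening
    refine (support_convolution_subset _).trans ?_
    rintro _ ⟨t, ht, y, hy, rfl⟩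
    rw [ρ.support_normed_eq] at ht
    refine Metric.mem_cthickening_of_dist_le _ (y + a) _ _ ⟨y, ?_, rfl⟩ ?_
    · by_contra hyK
      exact hy (hvK y hyK)
    · simp only
      rw [add_comm y a, dist_add_right]
      exact (Metric.mem_ball.1 ht).le.trans (min_le_left _ _)
  have hcs : HasCompactSupport ψ :=
    hKa.cthickening.of_isClosed_subset (isClosed_tsupport _) hsupp
  let φ : 𝓓(Ω, ℝ) := ⟨ψ, ρ.hasCompactSupport_normed.contDiff_convolution_left _
    ρ.contDiff_normed hvi.locallyIntegrable, hcs, hsupp.trans hrΩ⟩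
  have hle : ∀ F : EuclideanSpace ℝ (Fin n) → ENNReal,
      (∀ t, ‖t‖ < δ → F t ≤ ENNReal.ofReal ε) → ∫⁻ t, F t ∂π ≤ ENNReal.ofReal ε := by
    intro F hF
    have hae : ∀ᵐ t ∂π, F t ≤ ENNReal.ofReal ε := by
      rw [ae_withDensity_iff hρm.ennreal_ofReal]
      refine .of_forall fun t ht => hF t (hρδ t fun h0 => ht ?_)
      rw [h0, ENNReal.ofReal_zero]
    refine (lintegral_mono_ae hae).trans ?_
    rw [lintegral_const, measure_univ, mul_one]
  refine ⟨φ, ?_, ?_⟩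
  · calc modular M volume (fun x => (φ x - v x) / (2 * k))
        = modular M volume (fun x => ∫ t, (v (x - t) - v x) / (2 * k) ∂π) := by
          congr 1; ext x
          rw [integral_div, integral_sub (hvπ x) (integrable_const _), ← hψ]
          simp [φ]
      _ ≤ ∫⁻ t, modular M volume (fun x => (v (x - t) - v x) / (2 * k)) ∂π :=
          hM.modular_integral_le π (G := fun t x => (v (x - t) - v x) / (2 * k)) (by
            simp only [Function.uncurry_def]; fun_prop)
      _ ≤ ENNReal.ofReal ε :=
          hle _ fun t ht => h1 t (ht.trans_le (min_le_left _ _)) fun _ => rfl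
  · have hDm := measurable_holderQuotient (s := s) hvm
    -- Taking Hölder quotients commutes with translation once the pair is shifted diagonally.
    have hD : ∀ t (p : EuclideanSpace ℝ (Fin n) × EuclideanSpace ℝ (Fin n)),
        holderQuotient s v (p - (t, t)) = (v (p.1 - t) - v (p.2 - t)) / ‖p.1 - p.2‖ ^ s := by
      intro t p
      simp [holderQuotient]
    calc modular M (nu n) (fun p => (holderQuotient s φ p - holderQuotient s v p) / (2 * k))
        = modular M (nu n) (fun p => ∫ t,
            (holderQuotient s v (p - (t, t)) - holderQuotient s v p) / (2 * k) ∂π) := by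
          congr 1; ext p
          simp only [hD]
          have hi : Integrable (fun t => (v (p.1 - t) - v (p.2 - t)) / ‖p.1 - p.2‖ ^ s) π :=
            ((hvπ p.1).sub (hvπ p.2)).div_const _
          rw [integral_div, integral_sub hi (integrable_const _), integral_div,
            integral_sub (hvπ p.1) (hvπ p.2), ← hψ, ← hψ]
          simp [φ, holderQuotient]
      _ ≤ ∫⁻ t, modular M (nu n) (fun p =>
            (holderQuotient s v (p - (t, t)) - holderQuotient s v p) / (2 * k)) ∂π :=
          hM.modular_integral_le π (G := fun t p =>
            (holderQuotient s v (p - (t, t)) - holderQuotient s v p) / (2 * k)) (by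
            simp only [Function.uncurry_def]; fun_prop)
      _ ≤ ENNReal.ofReal ε :=
          hle _ fun t ht => h2 (t, t) (by
            simpa using ht.trans_le (min_le_right _ _)) fun p => by simp

end FracOrlicz

namespace FracOrlicz

/-! ### Multiplication by cut-off functions -/

variable {n : ℕ} {s : ℝ} {M : ℝ → ℝ}

/-- The bound `min (‖z‖ ^ (1 - s)) (‖z‖ ^ (-s))` for the Hölder quotients of a bounded Lipschitz
function. -/
noncomputable def cutoffKernel (s : ℝ) (z : EuclideanSpace ℝ (Fin n)) : ℝ :=
  min (‖z‖ ^ (1 - s)) (‖z‖ ^ (-s))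

theorem measurable_cutoffKernel : Measurable (cutoffKernel (n := n) s) := by
  unfold cutoffKernel
  fun_prop

theorem cutoffKernel_nonneg (z : EuclideanSpace ℝ (Fin n)) : 0 ≤ cutoffKernel s z :=
  le_min (by positivity) (by positivity)

theorem cutoffKernel_le_one (hs0 : 0 < s) (hs1 : s < 1) (z : EuclideanSpace ℝ (Fin n)) :
    cutoffKernel s z ≤ 1 := by
  rcases le_total ‖z‖ 1 with h | h
  · exact (min_le_left _ _).trans (Real.rpow_le_one (norm_nonneg _) h (by linarith))
  · exact (min_le_right _ _).trans (Real.rpow_le_one_of_one_le_of_nonpos h (by linarith))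

theorem abs_holderQuotient_le {η : EuclideanSpace ℝ (Fin n) → ℝ} {C : ℝ}
    (hη : ∀ x y, |η x - η y| ≤ C * min ‖x - y‖ 1)
    (p : EuclideanSpace ℝ (Fin n) × EuclideanSpace ℝ (Fin n)) :
    |holderQuotient s η p| ≤ C * cutoffKernel s (p.1 - p.2) := by
  have h := hη p.1 p.2
  rw [holderQuotient, cutoffKernel, abs_div, abs_of_nonneg (by positivity : 0 ≤ ‖p.1 - p.2‖ ^ s)]
  rcases (norm_nonneg (p.1 - p.2)).eq_or_lt with h0 | h0
  · rw [← h0] at h ⊢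
    have h1 : |η p.1 - η p.2| = 0 := le_antisymm (by simpa using h) (abs_nonneg _)
    rw [h1, zero_div]
    -- As `C` has no prescribed sign, the kernel itself must vanish on the diagonal; this uses the
    -- convention `0 ^ (-s) = 0` for `s ≠ 0`.
    by_cases h2 : s = 0
    · simp [h2]
    · have : (0 : ℝ) ^ (-s) = 0 := Real.zero_rpow (neg_ne_zero.2 h2)
      have h3 : (0 : ℝ) ≤ 0 ^ (1 - s) := by positivity
      rw [this, min_eq_right h3, mul_zero]
  · have hpos : 0 < ‖p.1 - p.2‖ ^ s := by positivity
    rw [div_le_iff₀ hpos, mul_assoc, min_mul_of_nonneg _ _ hpos.le, ← Real.rpow_add h0,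
      ← Real.rpow_add h0]
    simpa using h

/-- In polar coordinates the radial density is `r ^ (-s)` near `0` and `r ^ (-1 - s)` at infinity,
integrable exactly because `0 < s < 1`. In dimension `0` the integrand vanishes. -/
theorem lintegral_cutoffKernel_lt_top (hs0 : 0 < s) (hs1 : s < 1) :
    ∫⁻ z : EuclideanSpace ℝ (Fin n), ENNReal.ofReal (1 / ‖z‖ ^ n * cutoffKernel s z) < ⊤ := by
  rcases n.eq_zero_or_pos with rfl | hn
  · have : ∀ z : EuclideanSpace ℝ (Fin 0), ENNReal.ofReal (1 / ‖z‖ ^ 0 * cutoffKernel s z) = 0 := by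
      intro z
      rw [Subsingleton.elim z 0]
      have : (0 : ℝ) ^ (1 - s) = 0 := Real.zero_rpow (by linarith)
      simp [cutoffKernel, this]
    simp only [this, lintegral_zero, ENNReal.zero_lt_top]
  · have : Nonempty (Fin n) := ⟨⟨0, hn⟩⟩
    set F : ℝ → ℝ := fun r => 1 / r ^ n * min (r ^ (1 - s)) (r ^ (-s)) with hF
    have hFm : Measurable F := by fun_prop
    have hrad : ∀ r : ℝ, 0 < r → r ^ (n - 1) * F r = min (r ^ (-s)) (r ^ (-1 - s)) := by
      intro r hr
      have h1 : r ^ (n - 1) * (1 / r ^ n) = r ^ (-1 : ℝ) := by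
        rw [Real.rpow_neg_one]
        obtain ⟨m, rfl⟩ := Nat.exists_eq_succ_of_ne_zero hn.ne'
        rw [Nat.succ_eq_add_one, Nat.add_sub_cancel, pow_succ]
        field_simp
      rw [hF, ← mul_assoc, h1, mul_min_of_nonneg _ _ (by positivity), ← Real.rpow_add hr,
        ← Real.rpow_add hr]
      ring_nf
    have hint : IntegrableOn (fun r => r ^ (n - 1) • F r) (Ioi 0) := by
      rw [← Ioc_union_Ioi_eq_Ioi zero_le_one]
      refine IntegrableOn.union ?_ ?_
      · have h1 : IntegrableOn (fun r : ℝ => r ^ (-s)) (Ioc 0 1) :=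
          (intervalIntegrable_iff_integrableOn_Ioc_of_le zero_le_one).1
            (intervalIntegral.intervalIntegrable_rpow' (by linarith))
        refine Integrable.mono' h1 (by fun_prop) ?_
        filter_upwards [ae_restrict_mem measurableSet_Ioc] with r hr
        have := hr.1
        rw [smul_eq_mul, hrad r hr.1, Real.norm_of_nonneg (le_min (by positivity) (by positivity))]
        exact min_le_left _ _
      · have h1 : IntegrableOn (fun r : ℝ => r ^ (-1 - s)) (Ioi 1) :=
          integrableOn_Ioi_rpow_of_lt (by linarith) one_pos
        refine Integrable.mono' h1 (by fun_prop) ?_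
        filter_upwards [ae_restrict_mem measurableSet_Ioi] with r hr
        have : 0 < r := one_pos.trans hr
        rw [smul_eq_mul, hrad r this, Real.norm_of_nonneg (le_min (by positivity) (by positivity))]
        exact min_le_right _ _
    have hI : Integrable (fun z : EuclideanSpace ℝ (Fin n) => F ‖z‖) := by
      rw [integrable_fun_norm_addHaar, finrank_euclideanSpace_fin]
      exact hint
    have := hI.2
    rwa [hasFiniteIntegral_iff_ofReal] at this
    exact .of_forall fun z => mul_nonneg (by positivity) (cutoffKernel_nonneg z)

namespace IsYoungFunction

variable (hM : IsYoungFunction M)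
include hM

/-- Since the kernel is at most `1`, convexity pulls it out of `M`; Tonelli and translation
invariance then factor the double integral into the kernel's mass times the modular of `u`. -/
theorem mul_cutoffKernel_mem_orliczSpace (hs0 : 0 < s) (hs1 : s < 1)
    {u : EuclideanSpace ℝ (Fin n) → ℝ} (hum : Measurable u) (hu : u ∈ orliczSpace M volume) :
    (fun p : EuclideanSpace ℝ (Fin n) × EuclideanSpace ℝ (Fin n) =>
      u p.2 * cutoffKernel s (p.1 - p.2)) ∈ orliczSpace M (nu n) ∧
    (fun p : EuclideanSpace ℝ (Fin n) × EuclideanSpace ℝ (Fin n) =>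
      u p.1 * cutoffKernel s (p.1 - p.2)) ∈ orliczSpace M (nu n) := by
  obtain ⟨-, k, hk, hu⟩ := hu
  have hκ := measurable_cutoffKernel (n := n) (s := s)
  set κ : EuclideanSpace ℝ (Fin n) → ENNReal := fun z =>
    ENNReal.ofReal (1 / ‖z‖ ^ n * cutoffKernel s z) with hκdef
  have hκm : Measurable κ := by fun_prop
  have hκtop : ∫⁻ z, κ z < ⊤ := lintegral_cutoffKernel_lt_top hs0 hs1
  have hMm : Measurable fun x => ENNReal.ofReal (M (u x / k)) :=
    (hM.continuous.measurable.comp (hum.div_const k)).ennreal_ofReal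
  have hle : ∀ f : EuclideanSpace ℝ (Fin n) × EuclideanSpace ℝ (Fin n) →
      EuclideanSpace ℝ (Fin n), Measurable f →
      modular M (nu n) (fun p => u (f p) * cutoffKernel s (p.1 - p.2) / k) ≤
        ∫⁻ p, κ (p.1 - p.2) * ENNReal.ofReal (M (u (f p) / k)) := by
    intro f hf
    have hm : Measurable fun p => ENNReal.ofReal (M (u (f p) * cutoffKernel s (p.1 - p.2) / k)) :=
      (hM.continuous.measurable.comp (by fun_prop)).ennreal_ofReal
    refine (lintegral_withDensity_eq_lintegral_mul _ measurable_nu_weight.ennreal_ofReal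
      hm).trans_le (lintegral_mono fun p => ?_)
    have hc := cutoffKernel_nonneg (s := s) (p.1 - p.2)
    simp only [Pi.mul_apply, hκdef]
    rw [← ENNReal.ofReal_mul (by positivity), ← ENNReal.ofReal_mul (by positivity), mul_assoc]
    refine ENNReal.ofReal_le_ofReal (mul_le_mul_of_nonneg_left ?_ (by positivity))
    have := hM.map_mul_le hc (cutoffKernel_le_one hs0 hs1 _) (u (f p) / k)
    rwa [← mul_div_assoc, mul_comm _ (u (f p))] at this
  have hκ' : Measurable fun p : EuclideanSpace ℝ (Fin n) × EuclideanSpace ℝ (Fin n) =>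
    cutoffKernel s (p.1 - p.2) := hκ.comp (measurable_fst.sub measurable_snd)
  have hκm' : Measurable fun p : EuclideanSpace ℝ (Fin n) × EuclideanSpace ℝ (Fin n) =>
    κ (p.1 - p.2) := hκm.comp (measurable_fst.sub measurable_snd)
  refine ⟨⟨((hum.comp measurable_snd).mul hκ').aestronglyMeasurable, k, hk,
      (hle _ measurable_snd).trans_lt ?_⟩,
    ⟨((hum.comp measurable_fst).mul hκ').aestronglyMeasurable, k, hk,
      (hle _ measurable_fst).trans_lt ?_⟩⟩
  · calc ∫⁻ p : EuclideanSpace ℝ (Fin n) × EuclideanSpace ℝ (Fin n),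
          κ (p.1 - p.2) * ENNReal.ofReal (M (u p.2 / k))
        = ∫⁻ y, ∫⁻ x, κ (x - y) * ENNReal.ofReal (M (u y / k)) :=
          lintegral_prod_symm _ (hκm'.mul (hMm.comp measurable_snd)).aemeasurable
      _ = (∫⁻ z, κ z) * modular M volume (fun x => u x / k) := by
          rw [modular, ← lintegral_const_mul _ hMm]
          refine lintegral_congr fun y => ?_
          rw [lintegral_mul_const' _ _ ENNReal.ofReal_ne_top, lintegral_sub_right_eq_self κ y]
      _ < ⊤ := ENNReal.mul_lt_top hκtop hu
  · calc ∫⁻ p : EuclideanSpace ℝ (Fin n) × EuclideanSpace ℝ (Fin n),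
          κ (p.1 - p.2) * ENNReal.ofReal (M (u p.1 / k))
        = ∫⁻ x, ∫⁻ y, κ (x - y) * ENNReal.ofReal (M (u x / k)) :=
          lintegral_prod _ (hκm'.mul (hMm.comp measurable_fst)).aemeasurable
      _ = (∫⁻ z, κ z) * modular M volume (fun x => u x / k) := by
          rw [modular, ← lintegral_const_mul _ hMm]
          refine lintegral_congr fun x => ?_
          rw [lintegral_mul_const' _ _ ENNReal.ofReal_ne_top, lintegral_sub_left_eq_self κ x]
      _ < ⊤ := ENNReal.mul_lt_top hκtop hu

/-- Leibniz rule: `Dˢ(ηu)(x, y) = η(x) Dˢu(x, y) + u(y) Dˢη(x, y)`, the last factor being bounded by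
the cut-off kernel. -/
theorem mul_mem_fracSobolev (hs0 : 0 < s) (hs1 : s < 1) {η u : EuclideanSpace ℝ (Fin n) → ℝ}
    (hηm : Measurable η) (hum : Measurable u) {B C : ℝ} (hB : ∀ x, |η x| ≤ B)
    (hη : ∀ x y, |η x - η y| ≤ C * min ‖x - y‖ 1) (hu : u ∈ fracSobolev s M) :
    (fun x => η x * u x) ∈ fracSobolev s M := by
  refine ⟨hM.orliczSpace_mono (hM.orliczSpace_const_mul hu.1 B) (by fun_prop)
    (.of_forall fun x => ?_), ?_⟩
  · rw [abs_mul, abs_mul]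
    exact mul_le_mul_of_nonneg_right ((hB x).trans (le_abs_self B)) (abs_nonneg _)
  · have hD := measurable_holderQuotient (s := s) hum
    have hDη := measurable_holderQuotient (s := s) hηm
    have h1 : (fun p => η p.1 * holderQuotient s u p) ∈ orliczSpace M (nu n) :=
      hM.orliczSpace_mono (hM.orliczSpace_const_mul hu.2 B) (by fun_prop)
        (.of_forall fun p => by
          rw [abs_mul, abs_mul]
          exact mul_le_mul_of_nonneg_right ((hB _).trans (le_abs_self B)) (abs_nonneg _))
    have h2 : (fun p => u p.2 * holderQuotient s η p) ∈ orliczSpace M (nu n) :=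
      hM.orliczSpace_mono (hM.orliczSpace_const_mul
        (hM.mul_cutoffKernel_mem_orliczSpace hs0 hs1 hum hu.1).1 C) (by fun_prop)
        (.of_forall fun p => by
          have h := abs_holderQuotient_le (s := s) hη p
          rw [abs_mul, mul_left_comm, abs_mul (u p.2)]
          exact mul_le_mul_of_nonneg_left (h.trans (le_abs_self _)) (abs_nonneg _))
    convert hM.orliczSpace_add h1 h2 using 2 with p
    simp only [holderQuotient]
    ring

end IsYoungFunction

theorem exists_bounds_of_contDiff {η : EuclideanSpace ℝ (Fin n) → ℝ} (hη : ContDiff ℝ 1 η)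
    (hc : HasCompactSupport η) :
    ∃ B C : ℝ, (∀ x, |η x| ≤ B) ∧ 0 ≤ C ∧ ∀ x y, |η x - η y| ≤ C * min ‖x - y‖ 1 := by
  obtain ⟨B, hB⟩ := hη.continuous.bounded_above_of_compact_support hc
  obtain ⟨L, hL⟩ := ContDiff.lipschitzWith_of_hasCompactSupport hc hη one_ne_zero
  have hB0 : 0 ≤ B := (norm_nonneg _).trans (hB 0)
  refine ⟨B, max L (2 * B), hB, by positivity, fun x y => ?_⟩
  rw [mul_min_of_nonneg _ _ (by positivity)]
  refine le_min ?_ ?_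
  · have := hL.dist_le_mul x y
    rw [Real.dist_eq, dist_eq_norm] at this
    exact this.trans (mul_le_mul_of_nonneg_right (le_max_left _ _) (norm_nonneg _))
  · have h1 := abs_sub (η x) (η y)
    have h2 := hB x
    have h3 := hB y
    rw [Real.norm_eq_abs] at h2 h3
    linarith [le_max_right (L : ℝ) (2 * B)]

/-- The Hölder quotient vanishes unless `x` or `y` lies in the support `K`, so it is dominated by
the kernel times `1_K(x) + 1_K(y)`. -/
theorem IsYoungFunction.mem_fracSobolev_of_contDiff (hM : IsYoungFunction M) (hs0 : 0 < s)
    (hs1 : s < 1) {φ : EuclideanSpace ℝ (Fin n) → ℝ} (hφ : ContDiff ℝ 1 φ)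
    (hc : HasCompactSupport φ) : φ ∈ fracSobolev s M := by
  obtain ⟨B, C, hB, hC0, hC⟩ := exists_bounds_of_contDiff hφ hc
  have hφm : Measurable φ := hφ.continuous.measurable
  have hKm : MeasurableSet (tsupport φ) := (isClosed_tsupport φ).measurableSet
  have hK : volume (tsupport φ) < ⊤ := hc.isCompact.measure_lt_top
  refine ⟨hM.mem_orliczSpace_of_bounded hφm.aestronglyMeasurable hB
    ((measure_mono (subset_tsupport φ)).trans_lt hK), ?_⟩
  have h1m : Measurable ((tsupport φ).indicator fun _ => (1 : ℝ)) := measurable_const.indicator hKm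
  have h1 : ((tsupport φ).indicator fun _ => (1 : ℝ)) ∈ orliczSpace M volume :=
    hM.mem_orliczSpace_of_bounded h1m.aestronglyMeasurable (C := 1)
      (fun x => by by_cases hx : x ∈ tsupport φ <;> simp [hx])
      ((measure_mono support_indicator_subset).trans_lt hK)
  obtain ⟨h2, h3⟩ := hM.mul_cutoffKernel_mem_orliczSpace hs0 hs1 h1m h1
  refine hM.orliczSpace_mono (hM.orliczSpace_const_mul (hM.orliczSpace_add h2 h3) C)
    (measurable_holderQuotient hφm).aestronglyMeasurable (.of_forall fun p => ?_)
  have hκ := cutoffKernel_nonneg (s := s) (p.1 - p.2)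
  have h := abs_holderQuotient_le (s := s) hC p
  have h0 : 0 ≤ C * cutoffKernel s (p.1 - p.2) := mul_nonneg hC0 hκ
  refine le_trans ?_ (le_abs_self _)
  by_cases hp1 : p.1 ∈ tsupport φ <;> by_cases hp2 : p.2 ∈ tsupport φ
  · simp [hp1, hp2]; linarith
  · simpa [hp1, hp2] using h
  · simpa [hp1, hp2] using h
  · simp [holderQuotient, image_eq_zero_of_notMem_tsupport hp1,
      image_eq_zero_of_notMem_tsupport hp2, hp1, hp2]

end FracOrlicz

namespace FracOrlicz

variable {n : ℕ} {s : ℝ} {M : ℝ → ℝ} {Ω : Opens (EuclideanSpace ℝ (Fin n))}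

/-! ### Elements of `W₀ˢL_M(Ω)` -/

theorem fracSobolevZero_subset : fracSobolevZero s M Ω ⊆ fracSobolev s M := by
  rintro _ ⟨u, -, rfl⟩
  exact u.2

theorem continuous_pairing_sigmaE {f : EuclideanSpace ℝ (Fin n) → ℝ}
    {F : EuclideanSpace ℝ (Fin n) × EuclideanSpace ℝ (Fin n) → ℝ}
    (hf : f ∈ orliczE (complementary M) volume) (hF : F ∈ orliczE (complementary M) (nu n)) :
    @Continuous _ _ (sigmaE n s M) _ fun u : fracSobolev (n := n) s M => pairing s f F u.1 :=
  continuous_iff_le_induced.2 <| (iInf₂_le f hf).trans (iInf₂_le F hF)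

theorem IsYoungFunction.testFunction_mem_fracSobolevZero (hM : IsYoungFunction M) (hs0 : 0 < s)
    (hs1 : s < 1) (φ : 𝓓(Ω, ℝ)) : (φ : EuclideanSpace ℝ (Fin n) → ℝ) ∈ fracSobolevZero s M Ω :=
  ⟨⟨φ, hM.mem_fracSobolev_of_contDiff hs0 hs1 (φ.contDiff.of_le (by exact_mod_cast le_top))
    φ.hasCompactSupport⟩, @subset_closure _ (sigmaE n s M) _ _ ⟨φ, rfl⟩, rfl⟩

/-- The sign of `u`, cut off to a bounded set outside `Ω`, lies in `E_M̄`. Its pairing vanishes on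
test functions, hence on their closure, so `∫ |u| = 0` over that set. -/
theorem IsYoungFunction.ae_eq_zero_of_mem_fracSobolevZero (hM : IsYoungFunction M)
    {u : EuclideanSpace ℝ (Fin n) → ℝ} (hu : u ∈ fracSobolevZero s M Ω) :
    ∀ᵐ x, x ∉ Ω → u x = 0 := by
  have huL : u ∈ orliczSpace M volume := (fracSobolevZero_subset hu).1
  set v := huL.1.mk u
  have hv : Measurable v := huL.1.stronglyMeasurable_mk.measurable
  have huv : u =ᵐ[volume] v := huL.1.ae_eq_mk
  have key : ∀ R : ℕ, ∀ᵐ x, x ∈ Metric.closedBall 0 (R : ℝ) ∩ (Ω : Set _)ᶜ → u x = 0 := by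
    intro R
    set A : Set (EuclideanSpace ℝ (Fin n)) := Metric.closedBall 0 (R : ℝ) ∩ (Ω : Set _)ᶜ
    have hA : MeasurableSet A := Metric.isClosed_closedBall.measurableSet.inter
      Ω.isOpen.measurableSet.compl
    set f : EuclideanSpace ℝ (Fin n) → ℝ := A.indicator fun x => if 0 ≤ v x then 1 else -1
    have hfm : Measurable f := (Measurable.ite (measurableSet_le measurable_const hv)
      measurable_const measurable_const).indicator hA
    have hfA : Function.support f ⊆ A := support_indicator_subset
    have hf : f ∈ orliczE (complementary M) volume :=
      hM.mem_orliczE_complementary_of_bounded hfm.aestronglyMeasurable (C := 1)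
        (fun x => by
          by_cases hx : x ∈ A
          · simp only [f, indicator_of_mem hx]; split_ifs <;> simp
          · simp [f, hx])
        (Metric.isBounded_closedBall.subset (hfA.trans inter_subset_left))
        ((measure_mono (hfA.trans inter_subset_left)).trans_lt
          (isCompact_closedBall _ _).measure_lt_top)
    have h0 : (fun _ => (0 : ℝ)) ∈ orliczE (complementary M) (nu n) :=
      hM.mem_orliczE_complementary_of_bounded (measurable_const).aestronglyMeasurable (C := 0)
        (by simp) (by simp) (by simp)
    have hclosed : @IsClosed _ (sigmaE n s M)
        {w : fracSobolev (n := n) s M | pairing s f (fun _ => 0) w.1 = 0} :=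
      @IsClosed.preimage _ _ (sigmaE n s M) _ _ (continuous_pairing_sigmaE hf h0) _
        (isClosed_singleton (x := (0 : ℝ)))
    have hpair : pairing s f (fun _ => 0) u = 0 := by
      obtain ⟨w, hw, rfl⟩ := hu
      refine (@closure_minimal _ (sigmaE n s M) _ _ ?_ hclosed) hw
      rintro w ⟨φ, hφ⟩
      have : ∀ x, f x * w.1 x = 0 := fun x => by
        by_cases hx : x ∈ A
        · rw [hφ, image_eq_zero_of_notMem_tsupport fun h => hx.2 (φ.tsupport_subset h), mul_zero]
        · simp [f, hx]
      simp [pairing, this]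
    have hae : (fun x => f x * u x) =ᵐ[volume] A.indicator fun x => |v x| := by
      filter_upwards [huv] with x hx
      by_cases hxA : x ∈ A
      · simp only [f, indicator_of_mem hxA, hx]
        split_ifs with h
        · rw [one_mul, abs_of_nonneg h]
        · rw [neg_one_mul, abs_of_neg (not_le.1 h)]
      · simp [f, hxA]
    have hint := (hM.integrable_mul hf.1 huL).congr hae
    have hz : ∫ x, A.indicator (fun x => |v x|) x = 0 := by
      rw [← integral_congr_ae hae]
      simpa [pairing] using hpair
    rw [integral_eq_zero_iff_of_nonneg
      (fun x => indicator_nonneg (fun x _ => abs_nonneg (v x)) x) hint] at hz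
    filter_upwards [hz, huv] with x hx hxv hxA
    rw [hxv]
    simpa [hxA] using hx
  filter_upwards [ae_all_iff.2 key] with x hx hxΩ
  obtain ⟨R, hR⟩ := exists_nat_ge ‖x‖
  exact hx R ⟨by simpa using hR, hxΩ⟩

theorem ModularlyApproximable.congr_ae {u v : EuclideanSpace ℝ (Fin n) → ℝ}
    (h : u =ᵐ[volume] v) (hu : ModularlyApproximable s M Ω u) : ModularlyApproximable s M Ω v := by
  obtain ⟨l, hl, hu⟩ := hu
  refine ⟨l, hl, fun ε hε => ?_⟩
  obtain ⟨φ, h1, h2⟩ := hu ε hε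
  refine ⟨φ, h1.trans_eq' (lintegral_congr_ae ?_), h2.trans_eq' (lintegral_congr_ae ?_)⟩
  · filter_upwards [h] with x hx
    rw [hx]
  · filter_upwards [holderQuotient_congr_ae (s := s) h] with p hp
    rw [hp]

open scoped Manifold ContDiff in
/-- A partition of unity on `closure Ω` by smooth functions such that `Ω` contains small
translates of the part of `closure Ω` in the support of each of them. -/
theorem SegmentProperty.exists_partition
    (hΩ : Bornology.IsBounded (Ω : Set (EuclideanSpace ℝ (Fin n))))
    (hseg : SegmentProperty (Ω : Set (EuclideanSpace ℝ (Fin n)))) :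
    ∃ (ι : Type) (J : Finset ι) (η : ι → EuclideanSpace ℝ (Fin n) → ℝ),
      (∀ i, ContDiff ℝ 1 (η i)) ∧ (∀ i, HasCompactSupport (η i)) ∧
      (∀ x ∈ closure (Ω : Set _), ∑ i ∈ J, η i x = 1) ∧
      ∀ i, ∀ δ : ℝ, 0 < δ → ∃ a : EuclideanSpace ℝ (Fin n), ‖a‖ < δ ∧
        ∀ x ∈ tsupport (η i) ∩ closure (Ω : Set _), x + a ∈ Ω := by
  obtain ⟨ι, c, e, r, τ₀, hr, hτ, -, -, he, -, hcover, hin⟩ := hseg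
  have hfr : IsCompact (frontier (Ω : Set (EuclideanSpace ℝ (Fin n)))) :=
    Metric.isCompact_of_isClosed_isBounded isClosed_frontier
      (hΩ.closure.subset frontier_subset_closure)
  obtain ⟨J, hJ⟩ := hfr.elim_finite_subcover (fun j => Metric.ball (c j) r)
    (fun j => Metric.isOpen_ball) hcover
  -- The index `none` is the interior piece, for which the translation can be zero; the others are
  -- boundary balls.
  let U : Option J → Set (EuclideanSpace ℝ (Fin n)) := fun i =>
    i.elim (Ω : Set _) fun j => Metric.ball (c j) r
  have hUo : ∀ i, IsOpen (U i) := by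
    rintro (_ | j)
    · exact Ω.isOpen
    · exact Metric.isOpen_ball
  have hUb : ∀ i, Bornology.IsBounded (U i) := by
    rintro (_ | j)
    · exact hΩ
    · exact Metric.isBounded_ball
  have hUc : closure (Ω : Set _) ⊆ ⋃ i, U i := by
    intro x hx
    by_cases hxΩ : x ∈ (Ω : Set _)
    · exact mem_iUnion_of_mem none hxΩ
    · have : x ∈ frontier (Ω : Set (EuclideanSpace ℝ (Fin n))) := by
        rw [frontier, Ω.isOpen.interior_eq]
        exact ⟨hx, hxΩ⟩
      obtain ⟨j, hj, hxj⟩ := mem_iUnion₂.1 (hJ this)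
      exact mem_iUnion_of_mem (some ⟨j, hj⟩) hxj
  obtain ⟨f, hf⟩ := SmoothPartitionOfUnity.exists_isSubordinate 𝓘(ℝ, EuclideanSpace ℝ (Fin n))
    isClosed_closure U hUo hUc
  refine ⟨Option J, Finset.univ, fun i => f i, fun i => ?_, fun i => ?_, fun x hx => ?_, ?_⟩
  · exact (f i).contMDiff.contDiff.of_le (by exact_mod_cast le_top)
  · exact Metric.isCompact_of_isClosed_isBounded (isClosed_tsupport _) ((hUb i).subset (hf i))
  · rw [← f.sum_eq_one hx, finsum_eq_sum_of_fintype]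
  · rintro (_ | j) δ hδ
    · exact ⟨0, by simpa using hδ, fun x hx => by rw [add_zero]; exact hf none hx.1⟩
    · have hpos : 0 < min τ₀ δ / 2 := by positivity
      have hlt : min τ₀ δ / 2 < min τ₀ δ := half_lt_self (by positivity)
      refine ⟨(min τ₀ δ / 2) • e j, ?_, fun x hx => ?_⟩
      · rw [norm_smul, he, mul_one, Real.norm_of_nonneg hpos.le]
        exact hlt.trans_le (min_le_right _ _)
      · exact hin j x ⟨hx.2, hf (some j) hx.1⟩ _ ⟨hpos, hlt.trans_le (min_le_left _ _)⟩

/-- Localization: each piece `η i * v` vanishes off a compact set that arbitrarily small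
translations carry into `Ω`, and the pieces sum to `v`. -/
theorem IsYoungFunction.modularlyApproximable_of_mem_fracSobolevZero (hM : IsYoungFunction M)
    (hs0 : 0 < s) (hs1 : s < 1) (hΩ : Bornology.IsBounded (Ω : Set (EuclideanSpace ℝ (Fin n))))
    (hseg : SegmentProperty (Ω : Set (EuclideanSpace ℝ (Fin n))))
    {u : EuclideanSpace ℝ (Fin n) → ℝ} (hu : u ∈ fracSobolevZero s M Ω) :
    ModularlyApproximable s M Ω u := by
  have huW := fracSobolevZero_subset hu
  -- A Borel representative vanishing everywhere off `Ω`, so that supports can be handled pointwise.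
  set v : EuclideanSpace ℝ (Fin n) → ℝ := (Ω : Set _).indicator (huW.1.1.mk u)
  have hvm : Measurable v :=
    huW.1.1.stronglyMeasurable_mk.measurable.indicator Ω.isOpen.measurableSet
  have huv : u =ᵐ[volume] v := by
    filter_upwards [huW.1.1.ae_eq_mk, hM.ae_eq_zero_of_mem_fracSobolevZero hu] with x h1 h2
    by_cases hx : x ∈ (Ω : Set _)
    · simp only [v, indicator_of_mem hx, h1]
    · simp only [v, indicator_of_notMem hx, h2 hx]
  have hvW : v ∈ fracSobolev s M :=
    ⟨hM.orliczSpace_mono huW.1 hvm.aestronglyMeasurable (huv.mono fun x hx => by rw [hx]),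
      hM.orliczSpace_mono huW.2 (measurable_holderQuotient hvm).aestronglyMeasurable
        ((holderQuotient_congr_ae huv).mono fun x hx => by rw [hx])⟩
  obtain ⟨ι, J, η, hη, hηc, hη1, htrans⟩ := hseg.exists_partition hΩ
  have hηm : ∀ i, Measurable (η i) := fun i => (hη i).continuous.measurable
  have hsum := ModularlyApproximable.sum (s := s) (Ω := Ω) hM J (u := fun i x => η i x * v x)
    (fun i _ => (hηm i).mul hvm) fun i _ => by
      obtain ⟨B, C, hB, -, hC⟩ := exists_bounds_of_contDiff (hη i) (hηc i)
      refine hM.modularlyApproximable_of_translate ((hηm i).mul hvm)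
        (hM.mul_mem_fracSobolev hs0 hs1 (hηm i) hvm hB hC hvW)
        ((hηc i).isCompact.inter_right isClosed_closure) (fun x hx => ?_) (htrans i)
      by_cases h1 : x ∈ tsupport (η i)
      · have : x ∉ (Ω : Set _) := fun h => hx ⟨h1, subset_closure h⟩
        simp [v, this]
      · rw [image_eq_zero_of_notMem_tsupport h1, zero_mul]
  refine hsum.congr_ae (Filter.EventuallyEq.trans (.of_forall fun x => ?_) huv.symm)
  rw [← Finset.sum_mul]
  by_cases hx : x ∈ (Ω : Set _)
  · rw [hη1 x (subset_closure hx), one_mul]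
  · simp [v, hx]

/-! ### Weak convergence -/

/-- Because the scale `l` does not change with `ε`, a single sequence with modulars at most `1 / (k
+ 1)` serves all pairs `(f, F)`. -/
theorem ModularlyApproximable.exists_seq_tendsto_pairing (hM : IsYoungFunction M) (hs0 : 0 < s)
    (hs1 : s < 1) {u : EuclideanSpace ℝ (Fin n) → ℝ} (huW : u ∈ fracSobolev s M)
    (hu : ModularlyApproximable s M Ω u) :
    ∃ φ : ℕ → 𝓓(Ω, ℝ), ∀ f ∈ orliczSpace (complementary M) volume,
      ∀ F ∈ orliczSpace (complementary M) (nu n),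
        Tendsto (fun k => pairing s f F (φ k)) atTop (𝓝 (pairing s f F u)) := by
  obtain ⟨l, hl, hu⟩ := hu
  choose φ hφ1 hφ2 using fun k : ℕ => hu (1 / ((k : ℝ) + 1)) Nat.one_div_pos_of_nat
  have hφW : ∀ k, (φ k : EuclideanSpace ℝ (Fin n) → ℝ) ∈ fracSobolev s M := fun k =>
    fracSobolevZero_subset (hM.testFunction_mem_fracSobolevZero hs0 hs1 (φ k))
  have hconv : ∀ {V : Type} [MeasurableSpace V] {μ : Measure V} {f w : V → ℝ} {ψ : ℕ → V → ℝ},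
      f ∈ orliczSpace (complementary M) μ → w ∈ orliczSpace M μ → (∀ k, ψ k ∈ orliczSpace M μ) →
      (∀ k : ℕ, modular M μ (fun x => (ψ k x - w x) / l) ≤ ENNReal.ofReal (1 / ((k : ℝ) + 1))) →
      Tendsto (fun k => ∫ x, f x * ψ k x ∂μ) atTop (𝓝 (∫ x, f x * w x ∂μ)) := by
    intro V _ μ f w ψ hf hw hψ hlim
    rw [Metric.tendsto_atTop]
    intro ε hε
    obtain ⟨δ, hδ, h⟩ := hM.exists_abs_integral_mul_le hf hl (half_pos hε)
    obtain ⟨N, hN⟩ := exists_nat_one_div_lt hδ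
    refine ⟨N, fun k hk => ?_⟩
    rw [Real.dist_eq, ← integral_sub (hM.integrable_mul hf (hψ k)) (hM.integrable_mul hf hw)]
    simp only [← mul_sub]
    refine (h _ ((hψ k).1.sub hw.1) ((hlim k).trans (ENNReal.ofReal_le_ofReal ?_))).trans_lt
      (half_lt_self hε)
    exact (Nat.one_div_le_one_div hk).trans hN.le
  exact ⟨φ, fun f hf F hF => (hconv hf huW.1 (fun k => (hφW k).1) hφ1).add
    (hconv hF huW.2 (fun k => (hφW k).2) hφ2)⟩

end FracOrlicz

/-! ### Independence of the representation, and weak density -/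

theorem theoremA2 (n : ℕ) (s : ℝ) (hs0 : 0 < s) (hs1 : s < 1)
    (M : ℝ → ℝ) (hM : FracOrlicz.IsYoungFunction M)
    (Ω : TopologicalSpace.Opens (EuclideanSpace ℝ (Fin n)))
    (hΩ : Bornology.IsBounded (Ω : Set (EuclideanSpace ℝ (Fin n))))
    (hseg : FracOrlicz.SegmentProperty (Ω : Set (EuclideanSpace ℝ (Fin n)))) :
    -- the pairing of `W⁻ˢL_M̄(Ω)` with `W₀ˢL_M(Ω)` does not depend on the representation
    (∀ T ∈ FracOrlicz.dualSpace s M Ω, ∀ z ∈ FracOrlicz.representations s M T,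
      ∀ z' ∈ FracOrlicz.representations s M T, ∀ u ∈ FracOrlicz.fracSobolevZero s M Ω,
        FracOrlicz.pairing s z.1 z.2 u = FracOrlicz.pairing s z'.1 z'.2 u) ∧
    -- `𝓓(Ω)` is contained in `W₀ˢL_M(Ω)` and dense for `σ(W₀ˢL_M(Ω), W⁻ˢL_M̄(Ω))`
    (∀ φ : TestFunction Ω ℝ ⊤, (φ : EuclideanSpace ℝ (Fin n) → ℝ) ∈
      FracOrlicz.fracSobolevZero s M Ω) ∧
    @Dense (FracOrlicz.fracSobolevZero s M Ω) (FracOrlicz.sigmaL s M Ω)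
      {u | ∃ φ : TestFunction Ω ℝ ⊤, (u : EuclideanSpace ℝ (Fin n) → ℝ) = φ} := by
  have hseq : ∀ u ∈ FracOrlicz.fracSobolevZero s M Ω, _ := fun u hu =>
    (hM.modularlyApproximable_of_mem_fracSobolevZero hs0 hs1 hΩ hseg
      hu).exists_seq_tendsto_pairing hM hs0 hs1 (FracOrlicz.fracSobolevZero_subset hu)
  have htest := hM.testFunction_mem_fracSobolevZero (Ω := Ω) hs0 hs1
  refine ⟨fun T _ z hz z' hz' u hu => ?_, htest, fun u => ?_⟩
  · obtain ⟨φ, hφ⟩ := hseq u hu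
    -- Along the test functions both pairings equal `T (φ k)`, so their limits coincide.
    refine tendsto_nhds_unique (hφ z.1 hz.1 z.2 hz.2.1) ?_
    refine (hφ z'.1 hz'.1 z'.2 hz'.2.1).congr fun k => ?_
    rw [← hz.2.2, ← hz'.2.2]
  · obtain ⟨φ, hφ⟩ := hseq u.1 u.2
    let ψ : ℕ → FracOrlicz.fracSobolevZero s M Ω := fun k => ⟨φ k, htest (φ k)⟩
    have hlim : Tendsto ψ atTop (@nhds _ (FracOrlicz.sigmaL s M Ω) u) := by
      simp only [nhds_iInf, tendsto_iInf, nhds_induced, tendsto_comap_iff]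
      exact fun T _ z hz => hφ z.1 hz.1 z.2 hz.2.1
    exact @mem_closure_of_tendsto _ (FracOrlicz.sigmaL s M Ω) _ _ _ _ _ _ hlim
      (.of_forall fun k => ⟨φ k, rfl⟩)
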